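/- Let $n\ge 1$, and let $\mathcal H_n$ be the Connes–Moscovici Hopf algebra over $\mathbb C$: as an algebra it is the crossed product $\mathcal F(N)\rtimes U(\mathfrak{gl}(n)^{\rm aff})$, where $\mathcal F(N)$ is the commutative algebra of polynomials in the Taylor coefficients $\alpha^i_{J}(\psi)=\partial_J\psi^i(0)$, $|J|\ge 2$, of diffeomorphisms $\psi$ of $\mathbb R^n$ with $\psi(0)=0$, $\psi'(0)=\mathrm{Id}$. In terms of the basis $X_k$ (translations), $Y_i^j$ (of $\mathfrak{gl}(n)$) of $\mathfrak{gl}(n)^{\rm aff}$, with $[X_k,X_l]=0$, $[Y_i^j,X_k]=\delta^j_kX_i$, $[Y_i^j,Y_k^l]=\delta^j_kY_i^l-\delta^l_iY_k^j$, the cross relations are $[X_k,\alpha^i_J]=\alpha^i_{Jk}-\sum_s\alpha^i_{sk}\alpha^s_J$ and $[Y_p^q,\alpha^i_{j_1\ldots j_r}]=\sum_{m:\,j_m=q}\alpha^i_{j_1\ldots p\ldots j_r}-\delta^i_p\alpha^q_{j_1\ldots j_r}$ (with $j_m$ replaced by $p$), and the Hopf algebra structure is determined by $$\Delta X_k=X_k\otimes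 1+1\otimes X_k+\sum_{i,j}\alpha^i_{jk}\otimes Y_i^j,$$ $\Delta Y_i^j=Y_i^j\otimes1+1\otimes Y_i^j$ and $\Delta\alpha^i_{jk}=\alpha^i_{jk}\otimes1+1\otimes\alpha^i_{jk}$. A (right-left) anti-Yetter–Drinfeld module over a Hopf algebra $H$ with antipode $S$ is a vector space $V$ that is a right $H$-module and a left $H$-comodule, $v\mapsto v_{(-1)}\otimes v_{(0)}\in H\otimes V$, such that $$(v\cdot h)_{(-1)}\otimes (v\cdot h)_{(0)}=S(h_{(3)})\,v_{(-1)}\,h_{(1)}\otimes v_{(0)}\cdot h_{(2)}\qquad (v\in V,\ h\in H).$$ Let $\delta:\mathcal H_n\to\mathbb C$ be the character that on $\mathfrak{gl}(n)^{\rm aff}$ is the trace of the adjoint representation ($\delta(X_k)=0$, $\delta(Y_i^j)=\delta_i^j$) and on $\mathcal F(N)$ is the counit. Let $\mathbb C_\delta$ be the one-dimensional space $\mathbb C$ with action $z\cdot h=\delta(h)z$ and trivial coaction $z\mapsto 1\otimes z$. Theorem. $\mathbb C_\delta$ is an anti-Yetter–Drinfeld module over $\mathcal H_n$, and it is the only finite-dimensional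 one up to isomorphism and direct sums: every finite-dimensional anti-Yetter–Drinfeld module $V$ over $\mathcal H_n$ is isomorphic, as a module and comodule, to the direct sum of $\dim V$ copies of $\mathbb C_\delta$. -/

import Mathlib

open scoped TensorProduct

/-- Generators of the Connes-Moscovici algebra: `X k` is the translation `X_k`, `Y i j` is the
element `Y_i^j` of `gl(n)`, and `al i J` is the Taylor coefficient function
`ψ ↦ (∂_J ψ^i)(0)`, where the multi-index `J` is a multiset of coordinate indices. -/
inductive CMGen (n : ℕ) : Type
  | X (k : Fin n) : CMGen n
  | Y (i j : Fin n) : CMGen n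
  | al (i : Fin n) (J : Multiset (Fin n)) : CMGen n

namespace CM

/-- The generators, in the free algebra. -/
def fX {n : ℕ} (k : Fin n) : FreeAlgebra ℂ (CMGen n) := FreeAlgebra.ι ℂ (CMGen.X k)

def fY {n : ℕ} (i j : Fin n) : FreeAlgebra ℂ (CMGen n) := FreeAlgebra.ι ℂ (CMGen.Y i j)

def fal {n : ℕ} (i : Fin n) (J : Multiset (Fin n)) : FreeAlgebra ℂ (CMGen n) :=
  FreeAlgebra.ι ℂ (CMGen.al i J)

end CM

open CM in
/-- The relations of the crossed product algebra `F(N) ⋊ U(g)`, `g = gl(n)^aff`.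
`Y_Y`, `Y_X`, `X_X` are the brackets of `g`; `al_zero`, `al_one` say that `ψ(0) = 0` and
`ψ'(0) = Id` for `ψ` in `N`, so that the algebra `F(N)` is the commutative polynomial algebra in
the `α^i_J` with `|J| ≥ 2`; `Y_al` and `X_al` are the action of `g` on `F(N)` that is
induced by the action of the affine group on `N`. -/
inductive CMRel (n : ℕ) : FreeAlgebra ℂ (CMGen n) → FreeAlgebra ℂ (CMGen n) → Prop
  | X_X (k l : Fin n) : CMRel n (fX k * fX l) (fX l * fX k)
  | Y_Y (i j k l : Fin n) : CMRel n (fY i j * fY k l - fY k l * fY i j)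
      ((if j = k then fY i l else 0) - (if l = i then fY k j else 0))
  | Y_X (i j k : Fin n) : CMRel n (fY i j * fX k - fX k * fY i j) (if j = k then fX i else 0)
  | al_zero (i : Fin n) : CMRel n (fal i 0) 0
  | al_one (i j : Fin n) : CMRel n (fal i {j}) (if i = j then 1 else 0)
  | al_al (i k : Fin n) (J K : Multiset (Fin n)) : CMRel n (fal i J * fal k K) (fal k K * fal i J)
  | Y_al (p q i : Fin n) (J : Multiset (Fin n)) :
      CMRel n (fY p q * fal i J - fal i J * fY p q)
        (J.count q • fal i (p ::ₘ J.erase q) - (if i = p then fal q J else 0))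
  | X_al (k i : Fin n) (J : Multiset (Fin n)) (hJ : J ≠ 0) :
      CMRel n (fX k * fal i J - fal i J * fX k)
        (fal i (k ::ₘ J) - ∑ s, fal i {s, k} * fal s J)

/-- The Connes-Moscovici algebra `H_n = F(N) ⋊ U(gl(n)^aff)`. -/
def CMHopf (n : ℕ) : Type := RingQuot (CMRel n)

namespace CM

noncomputable instance (n : ℕ) : Ring (CMHopf n) := inferInstanceAs (Ring (RingQuot (CMRel n)))

noncomputable instance (n : ℕ) : Algebra ℂ (CMHopf n) :=
  inferInstanceAs (Algebra ℂ (RingQuot (CMRel n)))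

noncomputable def toH (n : ℕ) : FreeAlgebra ℂ (CMGen n) →ₐ[ℂ] CMHopf n :=
  RingQuot.mkAlgHom ℂ (CMRel n)

noncomputable def X {n : ℕ} (k : Fin n) : CMHopf n := toH n (fX k)

noncomputable def Y {n : ℕ} (i j : Fin n) : CMHopf n := toH n (fY i j)

noncomputable def al {n : ℕ} (i : Fin n) (J : Multiset (Fin n)) : CMHopf n := toH n (fal i J)

section relations

variable {n : ℕ}

theorem toH_eq {a b : FreeAlgebra ℂ (CMGen n)} (h : CMRel n a b) : toH n a = toH n b :=
  RingQuot.mkAlgHom_rel ℂ h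

theorem X_X (k l : Fin n) : ⁅(X k : CMHopf n), X l⁆ = 0 := by
  have := toH_eq (CMRel.X_X k l)
  simp only [map_mul] at this
  rw [Ring.lie_def, sub_eq_zero]; exact this

theorem Y_Y (i j k l : Fin n) : ⁅(Y i j : CMHopf n), Y k l⁆ =
    (if j = k then Y i l else 0) - (if l = i then Y k j else 0) := by
  have := toH_eq (CMRel.Y_Y i j k l)
  simp only [map_mul, map_sub, apply_ite (toH n), map_zero] at this
  exact this

theorem Y_X (i j k : Fin n) : ⁅(Y i j : CMHopf n), X k⁆ = if j = k then X i else 0 := by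
  have := toH_eq (CMRel.Y_X i j k)
  simp only [map_mul, map_sub, apply_ite (toH n), map_zero] at this
  exact this

theorem al_zero (i : Fin n) : (al i 0 : CMHopf n) = 0 := by
  have := toH_eq (CMRel.al_zero i)
  simp only [map_zero] at this
  exact this

theorem al_one (i j : Fin n) : (al i {j} : CMHopf n) = if i = j then 1 else 0 := by
  have := toH_eq (CMRel.al_one i j)
  simp only [apply_ite (toH n), map_zero, map_one] at this
  exact this

theorem al_al (i k : Fin n) (J K : Multiset (Fin n)) :
    (al i J : CMHopf n) * al k K = al k K * al i J := by
  have := toH_eq (CMRel.al_al i k J K)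
  simp only [map_mul] at this
  exact this

theorem Y_al (p q i : Fin n) (J : Multiset (Fin n)) : ⁅(Y p q : CMHopf n), al i J⁆ =
    J.count q • al i (p ::ₘ J.erase q) - (if i = p then al q J else 0) := by
  have := toH_eq (CMRel.Y_al p q i J)
  simp only [map_mul, map_sub, apply_ite (toH n), map_zero, map_nsmul] at this
  exact this

theorem X_al (k i : Fin n) (J : Multiset (Fin n)) (hJ : J ≠ 0) : ⁅(X k : CMHopf n), al i J⁆ =
    al i (k ::ₘ J) - ∑ s, al i {s, k} * al s J := by
  have := toH_eq (CMRel.X_al k i J hJ)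
  simp only [map_mul, map_sub, map_sum] at this
  exact this

theorem X_comm (k l : Fin n) : (X k : CMHopf n) * X l = X l * X k :=
  sub_eq_zero.1 (X_X k l)

end relations

/-- Data in an algebra `B` that determine an algebra map out of the Connes-Moscovici algebra by
its values on `X_k`, `Y_i^j` and the second order Taylor coefficients `α^i_{jk}`. -/
structure LiftData (n : ℕ) (B : Type*) [Ring B] [Algebra ℂ B] where
  x : Fin n → B
  y : Fin n → Fin n → B
  p : Fin n → Fin n → Fin n → B
  S : Subalgebra ℂ B
  xx : ∀ k l, ⁅x k, x l⁆ = 0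
  yy : ∀ i j k l, ⁅y i j, y k l⁆ = (if j = k then y i l else 0) - (if l = i then y k j else 0)
  yx : ∀ i j k, ⁅y i j, x k⁆ = if j = k then x i else 0
  psymm : ∀ i j k, p i j k = p i k j
  yp : ∀ a b i j k, ⁅y a b, p i j k⁆ = (if b = j then p i a k else 0)
    + (if b = k then p i j a else 0) - (if i = a then p b j k else 0)
  bianchi : ∀ i s k m, ⁅x m, p i s k⁆ - ⁅x k, p i s m⁆ =
    ∑ t, p i t k * p t s m - ∑ t, p i t m * p t s k
  S_comm : ∀ a ∈ S, ∀ b ∈ S, a * b = b * a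
  p_mem : ∀ i j k, p i j k ∈ S
  x_mem : ∀ k, ∀ a ∈ S, ⁅x k, a⁆ ∈ S

section lie

variable {B : Type*} [Ring B]

theorem lie_mul' (x a b : B) : ⁅x, a * b⁆ = ⁅x, a⁆ * b + a * ⁅x, b⁆ := by
  simp only [Ring.lie_def]; noncomm_ring

theorem mul_lie' (x a b : B) : ⁅a * b, x⁆ = ⁅a, x⁆ * b + a * ⁅b, x⁆ := by
  simp only [Ring.lie_def]; noncomm_ring

theorem lie_add' (x a b : B) : ⁅x, a + b⁆ = ⁅x, a⁆ + ⁅x, b⁆ := by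
  simp only [Ring.lie_def]; noncomm_ring

theorem add_lie' (x a b : B) : ⁅a + b, x⁆ = ⁅a, x⁆ + ⁅b, x⁆ := by
  simp only [Ring.lie_def]; noncomm_ring

theorem lie_sub' (x a b : B) : ⁅x, a - b⁆ = ⁅x, a⁆ - ⁅x, b⁆ := by
  simp only [Ring.lie_def]; noncomm_ring

theorem lie_neg' (x a : B) : ⁅x, -a⁆ = -⁅x, a⁆ := by
  simp only [Ring.lie_def]; noncomm_ring

theorem neg_lie' (x a : B) : ⁅-a, x⁆ = -⁅a, x⁆ := by
  simp only [Ring.lie_def]; noncomm_ring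

theorem lie_zero' (x : B) : ⁅x, (0 : B)⁆ = 0 := by simp [Ring.lie_def]

theorem zero_lie' (x : B) : ⁅(0 : B), x⁆ = 0 := by simp [Ring.lie_def]

theorem lie_one' (x : B) : ⁅x, (1 : B)⁆ = 0 := by simp [Ring.lie_def]

theorem lie_sum' {ι : Type*} (s : Finset ι) (x : B) (f : ι → B) :
    ⁅x, ∑ i ∈ s, f i⁆ = ∑ i ∈ s, ⁅x, f i⁆ := by
  simp only [Ring.lie_def, Finset.mul_sum, Finset.sum_mul, Finset.sum_sub_distrib]

theorem sum_lie' {ι : Type*} (s : Finset ι) (x : B) (f : ι → B) :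
    ⁅∑ i ∈ s, f i, x⁆ = ∑ i ∈ s, ⁅f i, x⁆ := by
  simp only [Ring.lie_def, Finset.mul_sum, Finset.sum_mul, Finset.sum_sub_distrib]

theorem lie_nsmul' (m : ℕ) (x a : B) : ⁅x, m • a⁆ = m • ⁅x, a⁆ := by
  simp only [Ring.lie_def, mul_smul_comm, smul_mul_assoc, smul_sub]

theorem lie_lie' (x y a : B) : ⁅x, ⁅y, a⁆⁆ = ⁅⁅x, y⁆, a⁆ + ⁅y, ⁅x, a⁆⁆ := by
  simp only [Ring.lie_def]; noncomm_ring

theorem lie_swap' (x y : B) : ⁅x, y⁆ = -⁅y, x⁆ := by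
  simp only [Ring.lie_def]; noncomm_ring

theorem lie_ite_zero (P : Prop) [Decidable P] (x a : B) :
    ⁅x, (if P then a else 0)⁆ = if P then ⁅x, a⁆ else 0 := by
  split_ifs <;> simp [lie_zero']

theorem ite_zero_lie (P : Prop) [Decidable P] (x a : B) :
    ⁅(if P then a else 0), x⁆ = if P then ⁅a, x⁆ else 0 := by
  split_ifs <;> simp [zero_lie']

end lie

namespace LiftData

variable {n : ℕ} {B : Type*} [Ring B] [Algebra ℂ B] (D : LiftData n B)

/-- The image of `α^i_J`, for a list `J`. -/
def dl : List (Fin n) → Fin n → B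
  | [], _ => 0
  | k :: l, i => if l = [] then (if i = k then 1 else 0) else
      ⁅D.x k, dl l i⁆ + ∑ s, D.p i s k * dl l s

theorem dl_cons (k : Fin n) (l : List (Fin n)) (hl : l ≠ []) (i : Fin n) :
    D.dl (k :: l) i = ⁅D.x k, D.dl l i⁆ + ∑ s, D.p i s k * D.dl l s := by
  rw [dl, if_neg hl]

theorem dl_pair (k m i : Fin n) : D.dl [k, m] i = D.p i m k := by
  rw [dl_cons _ _ _ (by simp)]
  have h : ∀ s, D.dl [m] s = if s = m then 1 else 0 := fun s => by simp [dl]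
  simp only [h, lie_ite_zero, lie_one']
  simp

theorem dl_swap (k m : Fin n) (l : List (Fin n)) :
    D.dl (k :: m :: l) = D.dl (m :: k :: l) := by
  funext i
  by_cases hl : l = []
  · subst hl
    rw [dl_pair, dl_pair, D.psymm]
  rw [dl_cons _ k (m :: l) (by simp), dl_cons _ m (k :: l) (by simp)]
  simp only [dl_cons _ _ l hl]
  simp only [lie_add', lie_sum', lie_mul', mul_add, Finset.sum_add_distrib, Finset.mul_sum]
  have h1 : ⁅D.x k, ⁅D.x m, D.dl l i⁆⁆ = ⁅D.x m, ⁅D.x k, D.dl l i⁆⁆ := by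
    rw [lie_lie', D.xx, zero_lie', zero_add]
  have h2 : ∑ s, ⁅D.x k, D.p i s m⁆ * D.dl l s + ∑ s, ∑ t, D.p i s k * (D.p s t m * D.dl l t)
      = ∑ s, ⁅D.x m, D.p i s k⁆ * D.dl l s + ∑ s, ∑ t, D.p i s m * (D.p s t k * D.dl l t) := by
    rw [Finset.sum_comm, Finset.sum_comm (f := fun s t => D.p i s m * (D.p s t k * D.dl l t)),
      ← Finset.sum_add_distrib, ← Finset.sum_add_distrib]
    refine Finset.sum_congr rfl fun s _ => ?_
    simp only [← mul_assoc, ← Finset.sum_mul, ← add_mul]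
    congr 1
    have := D.bianchi i s k m
    rw [sub_eq_sub_iff_add_eq_add] at this
    rw [this, add_comm]
  rw [h1]
  have h3 := sub_eq_zero.2 h2
  rw [← sub_eq_zero, ← h3]
  abel

theorem dl_perm {l l' : List (Fin n)} (h : l.Perm l') : D.dl l = D.dl l' := by
  induction h with
  | nil => rfl
  | cons a h ih =>
    funext i
    simp only [dl, ih]
    congr 1
    simp only [eq_iff_iff]
    constructor <;> rintro rfl <;> simpa using h
  | swap a b l => exact D.dl_swap b a l
  | trans _ _ h1 h2 => exact h1.trans h2

/-- The image of `α^i_J`. -/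
def d (i : Fin n) (J : Multiset (Fin n)) : B :=
  Quot.liftOn J (fun l => D.dl l i) fun _ _ h => congrFun (D.dl_perm h) i

theorem d_zero (i : Fin n) : D.d i 0 = 0 := rfl

theorem d_one (i j : Fin n) : D.d i {j} = if i = j then 1 else 0 := by
  change D.dl [j] i = _
  simp [dl]

theorem d_cons (i k : Fin n) (J : Multiset (Fin n)) (hJ : J ≠ 0) :
    D.d i (k ::ₘ J) = ⁅D.x k, D.d i J⁆ + ∑ s, D.p i s k * D.d s J := by
  induction J using Quotient.inductionOn with
  | h l => exact D.dl_cons k l (by rintro rfl; exact hJ rfl) i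

theorem d_pair (i j k : Fin n) : D.d i {j, k} = D.p i j k := by
  change D.dl [j, k] i = _
  rw [dl_pair, D.psymm]

theorem d_mem (i : Fin n) (J : Multiset (Fin n)) : D.d i J ∈ D.S := by
  induction J using Multiset.induction generalizing i with
  | empty => rw [d_zero]; exact zero_mem _
  | cons k J ih =>
    by_cases hJ : J = 0
    · subst hJ
      rw [Multiset.cons_zero, d_one]
      split_ifs
      · exact one_mem _
      · exact zero_mem _
    · rw [D.d_cons _ _ _ hJ]
      exact add_mem (D.x_mem _ _ (ih i)) (sum_mem fun s _ => mul_mem (D.p_mem _ _ _) (ih s))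

theorem y_d (p q i : Fin n) (J : Multiset (Fin n)) : ⁅D.y p q, D.d i J⁆ =
    J.count q • D.d i (p ::ₘ J.erase q) - (if i = p then D.d q J else 0) := by
  induction J using Multiset.induction generalizing i with
  | empty => simp [d_zero, lie_zero']
  | cons k J ih =>
    by_cases hJ : J = 0
    · subst hJ
      rw [Multiset.cons_zero, d_one, d_one, lie_ite_zero, lie_one', Multiset.count_singleton]
      by_cases hq : q = k
      · subst hq
        simp [d_one]
      · simp [hq]
    · rw [D.d_cons _ _ _ hJ, lie_add', lie_lie', D.yx, ih, lie_sum']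
      simp only [lie_mul', D.yp, ih, lie_sub', lie_nsmul', lie_ite_zero, ite_zero_lie]
      have key : (k ::ₘ J).count q • D.d i (p ::ₘ (k ::ₘ J).erase q) =
          (if q = k then D.d i (p ::ₘ J) else 0) + J.count q • D.d i (k ::ₘ p ::ₘ J.erase q) := by
        by_cases hq : q = k
        · subst hq
          rw [Multiset.count_cons_self, Multiset.erase_cons_head, if_pos rfl, add_smul, one_smul,
            add_comm]
          by_cases hm : q ∈ J
          · rw [Multiset.cons_swap, Multiset.cons_erase hm]
          · rw [Multiset.count_eq_zero_of_notMem hm]; simp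
        · rw [Multiset.count_cons_of_ne hq, if_neg hq, zero_add,
            Multiset.erase_cons_tail _ (fun h => hq h.symm), Multiset.cons_swap]
      rw [key, D.d_cons _ _ _ hJ, D.d_cons _ _ _ hJ, D.d_cons _ _ _ (Multiset.cons_ne_zero)]
      simp only [add_mul, sub_mul, mul_sub, ite_mul, mul_ite, zero_mul, mul_zero, mul_smul_comm,
        Finset.sum_add_distrib, Finset.sum_sub_distrib, smul_add, Finset.smul_sum,
        Finset.sum_ite_eq, Finset.sum_ite_eq', Finset.mem_univ, if_true]
      have e1 : ∀ (P : Prop) [Decidable P] (f : Fin n → B),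
          (∑ s, if P then f s else 0) = if P then ∑ s, f s else 0 := by
        intro P _ f; split_ifs <;> simp
      simp only [e1]
      split_ifs <;> abel

/-- The algebra map out of the Connes-Moscovici algebra determined by the data. -/
noncomputable def lift : CMHopf n →ₐ[ℂ] B :=
  RingQuot.liftAlgHom ℂ ⟨FreeAlgebra.lift ℂ (fun g => match g with
    | CMGen.X k => D.x k
    | CMGen.Y i j => D.y i j
    | CMGen.al i J => D.d i J), by
    intro a b h
    cases h with
    | X_X k l => 
      have := D.xx k l
      rw [Ring.lie_def, sub_eq_zero] at this
      simpa [fX] using this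
    | Y_Y i j k l =>
      have := D.yy i j k l
      rw [Ring.lie_def] at this
      simp only [fY, map_sub, map_mul, apply_ite (FreeAlgebra.lift ℂ _), FreeAlgebra.lift_ι_apply,
        map_zero]
      exact this
    | Y_X i j k =>
      have := D.yx i j k
      rw [Ring.lie_def] at this
      simp only [fY, fX, map_sub, map_mul, apply_ite (FreeAlgebra.lift ℂ _),
        FreeAlgebra.lift_ι_apply, map_zero]
      exact this
    | al_zero i => simp [fal, d_zero]
    | al_one i j =>
      simp only [fal, apply_ite (FreeAlgebra.lift ℂ _), FreeAlgebra.lift_ι_apply, map_zero,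
        map_one]
      exact D.d_one i j
    | al_al i k J K =>
      simp only [fal, map_mul, FreeAlgebra.lift_ι_apply]
      exact D.S_comm _ (D.d_mem i J) _ (D.d_mem k K)
    | Y_al p q i J =>
      have := D.y_d p q i J
      rw [Ring.lie_def] at this
      simp only [fal, fY, map_sub, map_mul, map_nsmul, apply_ite (FreeAlgebra.lift ℂ _),
        FreeAlgebra.lift_ι_apply, map_zero]
      exact this
    | X_al k i J hJ =>
      have := D.d_cons i k J hJ
      rw [Ring.lie_def] at this
      simp only [fal, fX, map_sub, map_mul, map_sum, FreeAlgebra.lift_ι_apply, this, d_pair]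
      abel⟩

theorem lift_toH (a : FreeAlgebra ℂ (CMGen n)) : D.lift (toH n a) = FreeAlgebra.lift ℂ (fun g =>
    match g with
    | CMGen.X k => D.x k
    | CMGen.Y i j => D.y i j
    | CMGen.al i J => D.d i J) a :=
  RingQuot.liftAlgHom_mkAlgHom_apply ..

@[simp] theorem lift_X (k : Fin n) : D.lift (X k) = D.x k := by
  rw [X, lift_toH, fX, FreeAlgebra.lift_ι_apply]

@[simp] theorem lift_Y (i j : Fin n) : D.lift (Y i j) = D.y i j := by
  rw [Y, lift_toH, fY, FreeAlgebra.lift_ι_apply]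

@[simp] theorem lift_al (i : Fin n) (J : Multiset (Fin n)) : D.lift (al i J) = D.d i J := by
  rw [al, lift_toH, fal, FreeAlgebra.lift_ι_apply]

theorem lift_al2 (i j k : Fin n) : D.lift (al i {j, k}) = D.p i j k := by
  rw [lift_al, d_pair]

end LiftData

end CM

namespace CM

section computations

variable {n : ℕ} {B : Type*} [Ring B]

/-- The sum `∑ a^i_{jk} w_i^j`. -/
def W (a : Fin n → Fin n → Fin n → B) (w : Fin n → Fin n → B) (k : Fin n) : B :=
  ∑ i, ∑ j, a i j k * w i j

theorem sum_ite_const (P : Prop) [Decidable P] (f : Fin n → B) :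
    (∑ s, if P then f s else 0) = if P then ∑ s, f s else 0 := by
  split_ifs <;> simp

theorem lie_W (a : Fin n → Fin n → Fin n → B) (w : Fin n → Fin n → B) (T : B) (p q : Fin n)
    (ha : ∀ i j k, ⁅T, a i j k⁆ = (if q = j then a i p k else 0) + (if q = k then a i j p else 0)
      - (if i = p then a q j k else 0))
    (hw : ∀ i j, ⁅T, w i j⁆ = (if q = i then w p j else 0) - (if j = p then w i q else 0))
    (k : Fin n) : ⁅T, W a w k⁆ = if q = k then W a w p else 0 := by
  simp only [W, lie_sum', lie_mul', ha, hw, add_mul, sub_mul, mul_sub, ite_mul, mul_ite, zero_mul,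
    mul_zero, Finset.sum_add_distrib, Finset.sum_sub_distrib, sum_ite_const, Finset.sum_ite_eq,
    Finset.sum_ite_eq', Finset.mem_univ, if_true]
  abel

theorem W_lie (a b : Fin n → Fin n → Fin n → B) (w : Fin n → Fin n → B)
    (hab : ∀ i j k i' j' k', ⁅a i j k, b i' j' k'⁆ = 0)
    (hw : ∀ p q i j k, ⁅w p q, b i j k⁆ = (if q = j then b i p k else 0)
      + (if q = k then b i j p else 0) - (if i = p then b q j k else 0))
    (m i s k : Fin n) : ⁅W a w m, b i s k⁆ = ∑ t, a t s m * b i t k + ∑ t, a t k m * b i s t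
      - ∑ t, a i t m * b t s k := by
  simp only [W, sum_lie', mul_lie', hab, hw, mul_sub, mul_add, mul_ite, zero_mul, mul_zero,
    zero_add, Finset.sum_add_distrib, Finset.sum_sub_distrib, sum_ite_const, Finset.sum_ite_eq,
    Finset.sum_ite_eq', Finset.mem_univ, if_true]

theorem W_W_comul (a : Fin n → Fin n → Fin n → B) (w : Fin n → Fin n → B)
    (haa : ∀ i j k i' j' k', ⁅a i j k, a i' j' k'⁆ = 0)
    (hwa : ∀ p q i j k, ⁅w p q, a i j k⁆ = 0)
    (hw : ∀ p q i j, ⁅w p q, w i j⁆ = (if q = i then w p j else 0) - (if j = p then w i q else 0))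
    (k l : Fin n) : ⁅W a w k, W a w l⁆ =
      ∑ i, ∑ j, (∑ t, a i t k * a t j l - ∑ t, a i t l * a t j k) * w i j := by
  have h1 : ∀ i j, ⁅W a w k, a i j l⁆ = 0 := by
    intro i j
    simp [W, sum_lie', mul_lie', haa, hwa]
  have h2 : ∀ p q, ⁅W a w k, w p q⁆ = ∑ t, a t p k * w t q - ∑ t, a q t k * w p t := by
    intro p q
    have h3 : ∀ i j k, ⁅a i j k, w p q⁆ = 0 := fun i j k => by rw [lie_swap', hwa, neg_zero]
    simp only [W, sum_lie', mul_lie', h3, hw, mul_sub, mul_ite, zero_mul, mul_zero, zero_add,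
      Finset.sum_sub_distrib, sum_ite_const, Finset.sum_ite_eq, Finset.sum_ite_eq',
      Finset.mem_univ, if_true]
  rw [W.eq_def a w l]
  simp only [lie_sum', lie_mul', h1, h2, zero_mul, zero_add, mul_sub, sub_mul,
    Finset.sum_sub_distrib, Finset.mul_sum, Finset.sum_mul]
  have hc : ∀ i j k i' j' k', a i j k * a i' j' k' = a i' j' k' * a i j k :=
    fun i j k i' j' k' => sub_eq_zero.1 (haa i j k i' j' k')
  congr 1
  · trans ∑ t, ∑ j, ∑ i, a i t k * a t j l * w i j
    · refine Finset.sum_congr rfl fun _ _ => Finset.sum_congr rfl fun _ _ =>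
        Finset.sum_congr rfl fun _ _ => ?_
      rw [← mul_assoc, hc]
    · rw [Finset.sum_comm_cycle (f := fun i j t => a i t k * a t j l * w i j)]
      exact Finset.sum_congr rfl fun _ _ => Finset.sum_comm
  · refine Finset.sum_congr rfl fun _ _ => ?_
    rw [Finset.sum_comm]
    refine Finset.sum_congr rfl fun _ _ => Finset.sum_congr rfl fun _ _ => ?_
    rw [← mul_assoc]

theorem W_W_antipode (a : Fin n → Fin n → Fin n → B) (w : Fin n → Fin n → B)
    (haa : ∀ i j k i' j' k', ⁅a i j k, a i' j' k'⁆ = 0)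
    (hsymm : ∀ i j k, a i j k = a i k j)
    (hwa : ∀ p q i j k, ⁅w p q, a i j k⁆ = (if q = j then a i p k else 0)
      + (if q = k then a i j p else 0) - (if i = p then a q j k else 0))
    (hw : ∀ p q i j, ⁅w p q, w i j⁆ = (if q = i then w p j else 0) - (if j = p then w i q else 0))
    (k l : Fin n) : ⁅W a w k, W a w l⁆ =
      ∑ i, ∑ j, (∑ t, a i t l * a t j k - ∑ t, a i t k * a t j l) * w i j := by
  have h2 : ∀ p q, ⁅W a w k, w p q⁆ = -(if q = k then W a w p else 0) := by
    intro p q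
    rw [lie_swap', lie_W a w (w p q) p q (hwa p q) (hw p q)]
  have hc : ∀ i j k i' j' k', a i j k * a i' j' k' = a i' j' k' * a i j k :=
    fun i j k i' j' k' => sub_eq_zero.1 (haa i j k i' j' k')
  rw [W.eq_def a w l]
  simp only [lie_sum', lie_mul', h2, W_lie a a w haa hwa]
  simp only [mul_neg, mul_ite, mul_zero, Finset.sum_add_distrib, Finset.sum_neg_distrib,
    Finset.sum_ite_eq', Finset.mem_univ, if_true, sub_mul, add_mul, Finset.sum_sub_distrib]
  have h4 : ∑ p, ∑ q, (∑ t, a t l k * a p q t) * w p q = ∑ p, a p k l * W a w p := by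
    simp only [W, Finset.mul_sum, Finset.sum_mul, ← mul_assoc]
    rw [Finset.sum_comm_cycle]
    refine Finset.sum_congr rfl fun _ _ => ?_
    refine Finset.sum_congr rfl fun _ _ => Finset.sum_congr rfl fun _ _ => ?_
    rw [hsymm _ l k]
  have h5 : ∀ p q, ∑ t, a t q k * a p t l = ∑ t, a p t l * a t q k :=
    fun p q => Finset.sum_congr rfl fun _ _ => hc ..
  rw [h4]
  simp only [h5]
  abel

theorem adjoin_comm [Algebra ℂ B] (s : Set B) (h : ∀ a ∈ s, ∀ b ∈ s, a * b = b * a) :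
    ∀ a ∈ Algebra.adjoin ℂ s, ∀ b ∈ Algebra.adjoin ℂ s, a * b = b * a := by
  intro a ha b hb
  induction ha, hb using Algebra.adjoin_induction₂ with
  | mem_mem x y hx hy => exact h x hx y hy
  | algebraMap_both r t => exact Algebra.commutes r _
  | algebraMap_left r x _ => exact Algebra.commutes r x
  | algebraMap_right r x _ => exact (Algebra.commutes r x).symm
  | add_left x y z _ _ _ h1 h2 => rw [add_mul, mul_add, h1, h2]
  | add_right x y z _ _ _ h1 h2 => rw [add_mul, mul_add, h1, h2]
  | mul_left x y z _ _ _ h1 h2 => rw [mul_assoc, h2, ← mul_assoc, h1, mul_assoc]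
  | mul_right x y z _ _ _ h1 h2 => rw [← mul_assoc, h1, mul_assoc, h2, mul_assoc]

theorem adjoin_lie [Algebra ℂ B] (s : Set B) (x : B) (h : ∀ a ∈ s, ⁅x, a⁆ ∈ Algebra.adjoin ℂ s) :
    ∀ a ∈ Algebra.adjoin ℂ s, ⁅x, a⁆ ∈ Algebra.adjoin ℂ s := by
  intro a ha
  induction ha using Algebra.adjoin_induction with
  | mem a ha => exact h a ha
  | algebraMap r =>
    rw [Ring.lie_def, Algebra.commutes, sub_self]; exact zero_mem _
  | add a b _ _ h1 h2 => rw [lie_add']; exact add_mem h1 h2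
  | mul a b ha hb h1 h2 => rw [lie_mul']; exact add_mem (mul_mem h1 hb) (mul_mem ha h2)

end computations

section secondOrder

variable {n : ℕ}

/-- The second order Taylor coefficient `α^i_{jk}` (written `δ^i_{jk}` by Connes and Moscovici). -/
noncomputable def al2 (i j k : Fin n) : CMHopf n := al i {j, k}

theorem al2_symm (i j k : Fin n) : (al2 i j k : CMHopf n) = al2 i k j := by
  rw [al2, al2, Multiset.pair_comm]

theorem al2_al2 (i j k i' j' k' : Fin n) : ⁅(al2 i j k : CMHopf n), al2 i' j' k'⁆ = 0 :=
  sub_eq_zero.2 (al_al ..)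

theorem Y_al2 (p q i j k : Fin n) : ⁅(Y p q : CMHopf n), al2 i j k⁆ =
    (if q = j then al2 i p k else 0) + (if q = k then al2 i j p else 0)
      - (if i = p then al2 q j k else 0) := by
  rw [al2, Y_al]
  congr 1
  by_cases h1 : q = j
  · subst h1
    by_cases h2 : q = k
    · subst h2
      simp [al2, Multiset.pair_comm q p, two_smul]
    · simp [al2, h2]
  · by_cases h2 : q = k
    · subst h2
      have : ({j, q} : Multiset (Fin n)).erase q = {j} := by
        rw [Multiset.pair_comm]; simp
      rw [this]
      have h3 : ({j, q} : Multiset (Fin n)).count q = 1 := by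
        rw [Multiset.insert_eq_cons, Multiset.count_cons_of_ne h1]; simp
      rw [h3]
      simp only [one_smul, if_neg h1, if_pos, zero_add, al2]
      rw [Multiset.pair_comm]; rfl
    · simp [h1, h2]

theorem X_al2 (i s k m : Fin n) : ⁅(X m : CMHopf n), al2 i s k⁆ - ⁅(X k : CMHopf n), al2 i s m⁆ =
    ∑ t, al2 i t k * al2 t s m - ∑ t, al2 i t m * al2 t s k := by
  have h : (m ::ₘ {s, k} : Multiset (Fin n)) = k ::ₘ {s, m} := by
    simp only [Multiset.insert_eq_cons, ← Multiset.cons_zero]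
    rw [Multiset.cons_swap m s, Multiset.cons_swap k s, Multiset.cons_swap m k]
  simp only [al2]
  rw [X_al _ _ _ (by simp), X_al _ _ _ (by simp), h]
  abel

/-- The subalgebra `F(N)`. -/
noncomputable def FN (n : ℕ) : Subalgebra ℂ (CMHopf n) :=
  Algebra.adjoin ℂ (Set.range fun q : Fin n × Multiset (Fin n) => al q.1 q.2)

theorem al_mem (i : Fin n) (J : Multiset (Fin n)) : al i J ∈ FN n :=
  Algebra.subset_adjoin ⟨(i, J), rfl⟩

theorem FN_comm : ∀ a ∈ FN n, ∀ b ∈ FN n, a * b = b * a := by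
  refine adjoin_comm _ ?_
  rintro _ ⟨a, rfl⟩ _ ⟨b, rfl⟩
  exact al_al ..

theorem X_lie_al_mem (k i : Fin n) (J : Multiset (Fin n)) : (⁅(X k : CMHopf n), al i J⁆ : CMHopf n) ∈ FN n := by
  by_cases hJ : J = 0
  · rw [hJ, al_zero, lie_zero']; exact zero_mem _
  · rw [X_al _ _ _ hJ]
    exact sub_mem (al_mem _ _) (sum_mem fun _ _ => mul_mem (al_mem _ _) (al_mem _ _))

theorem Y_lie_al_mem (p q i : Fin n) (J : Multiset (Fin n)) : (⁅(Y p q : CMHopf n), al i J⁆ : CMHopf n) ∈ FN n := by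
  rw [Y_al]
  refine sub_mem (nsmul_mem (al_mem _ _) _) ?_
  split_ifs
  · exact al_mem _ _
  · exact zero_mem _

theorem X_lie_mem (k : Fin n) : ∀ a ∈ FN n, (⁅(X k : CMHopf n), a⁆ : CMHopf n) ∈ FN n :=
  adjoin_lie _ _ (by rintro _ ⟨a, rfl⟩; exact X_lie_al_mem _ _ _)

theorem Y_lie_mem (p q : Fin n) : ∀ a ∈ FN n, (⁅(Y p q : CMHopf n), a⁆ : CMHopf n) ∈ FN n :=
  adjoin_lie _ _ (by rintro _ ⟨a, rfl⟩; exact Y_lie_al_mem _ _ _ _)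

/-- The Connes-Moscovici algebra is generated by `X_k`, `Y_i^j` and `α^i_{jk}`. -/
theorem generated (T : Subalgebra ℂ (CMHopf n)) (hX : ∀ k, X k ∈ T) (hY : ∀ i j, Y i j ∈ T)
    (hal : ∀ i j k, al2 i j k ∈ T) (h : CMHopf n) : h ∈ T := by
  have hJ : ∀ (J : Multiset (Fin n)) (i : Fin n), al i J ∈ T := by
    intro J
    induction J using Multiset.induction with
    | empty => intro i; rw [al_zero]; exact zero_mem _
    | cons k J ih =>
      intro i
      by_cases hJ : J = 0
      · subst hJ
        rw [Multiset.cons_zero, al_one]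
        split_ifs
        · exact one_mem _
        · exact zero_mem _
      · have := X_al k i J hJ
        rw [eq_sub_iff_add_eq] at this
        rw [← this, Ring.lie_def]
        exact add_mem (sub_mem (mul_mem (hX k) (ih i)) (mul_mem (ih i) (hX k)))
          (sum_mem fun s _ => mul_mem (hal i s k) (ih s))
  obtain ⟨a, rfl⟩ : ∃ a, toH n a = h := RingQuot.mkAlgHom_surjective ℂ (CMRel n) h
  induction a using FreeAlgebra.induction with
  | grade0 r => rw [AlgHom.commutes]; exact T.algebraMap_mem r
  | grade1 g =>
    cases g with
    | X k => exact hX k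
    | Y i j => exact hY i j
    | al i J => exact hJ J i
  | mul a b ha hb => rw [map_mul]; exact mul_mem ha hb
  | add a b ha hb => rw [map_add]; exact add_mem ha hb

theorem hom_ext {B : Type*} [Semiring B] [Algebra ℂ B] {f g : CMHopf n →ₐ[ℂ] B}
    (hX : ∀ k, f (X k) = g (X k)) (hY : ∀ i j, f (Y i j) = g (Y i j))
    (hal : ∀ i j k, f (al2 i j k) = g (al2 i j k)) : f = g := by
  ext h
  exact generated (AlgHom.equalizer f g) hX hY hal h

end secondOrder

/-- The data of a character of `g` extended by the evaluation at the identity on `F(N)`. -/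
noncomputable def charData (n : ℕ) (c : ℂ) : LiftData n ℂ where
  x _ := 0
  y i j := if i = j then c else 0
  p _ _ _ := 0
  S := ⊤
  xx _ _ := by simp [Ring.lie_def]
  yy i j k l := by
    rw [Ring.lie_def, mul_comm, sub_self, eq_comm, sub_eq_zero]
    by_cases h1 : j = k <;> by_cases h2 : l = i <;> grind
  yx _ _ _ := by simp [Ring.lie_def]
  psymm _ _ _ := rfl
  yp _ _ _ _ _ := by simp [Ring.lie_def]
  bianchi _ _ _ _ := by simp [Ring.lie_def]
  S_comm a _ b _ := mul_comm a b
  p_mem _ _ _ := trivial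
  x_mem _ _ _ := trivial

/-- The counit: zero on `g`, evaluation at the identity on `F(N)`. -/
noncomputable def counit (n : ℕ) : CMHopf n →ₐ[ℂ] ℂ := (charData n 0).lift

/-- The modular character `δ`: on `g` it is the trace of the adjoint representation, that is
`δ(X_k) = 0` and `δ(Y_i^j)` is the Kronecker symbol; on `F(N)` it is the counit. -/
noncomputable def modularChar (n : ℕ) : CMHopf n →ₐ[ℂ] ℂ := (charData n 1).lift

open scoped TensorProduct

section comulData

variable {n : ℕ}

theorem inl_lie (a b : CMHopf n) : ⁅a ⊗ₜ[ℂ] (1 : CMHopf n), b ⊗ₜ[ℂ] (1 : CMHopf n)⁆ =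
    ⁅a, b⁆ ⊗ₜ 1 := by
  simp [Ring.lie_def, TensorProduct.sub_tmul]

theorem inr_lie (a b : CMHopf n) : ⁅(1 : CMHopf n) ⊗ₜ[ℂ] a, (1 : CMHopf n) ⊗ₜ[ℂ] b⁆ =
    1 ⊗ₜ ⁅a, b⁆ := by
  simp [Ring.lie_def, TensorProduct.tmul_sub]

theorem inl_inr_lie (a b : CMHopf n) : ⁅a ⊗ₜ[ℂ] (1 : CMHopf n), (1 : CMHopf n) ⊗ₜ[ℂ] b⁆ = 0 := by
  simp [Ring.lie_def]

theorem inr_inl_lie (a b : CMHopf n) : ⁅(1 : CMHopf n) ⊗ₜ[ℂ] a, b ⊗ₜ[ℂ] (1 : CMHopf n)⁆ = 0 := by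
  simp [Ring.lie_def]

theorem ite_tmul' (P : Prop) [Decidable P] (a b : CMHopf n) :
    (if P then a else 0) ⊗ₜ[ℂ] b = if P then a ⊗ₜ b else 0 := by
  split_ifs <;> simp

theorem tmul_ite' (P : Prop) [Decidable P] (a b : CMHopf n) :
    b ⊗ₜ[ℂ] (if P then a else 0) = if P then b ⊗ₜ a else 0 := by
  split_ifs <;> simp

/-- The subalgebra `F(N) ⊗ F(N)`. -/
noncomputable def FN2 (n : ℕ) : Subalgebra ℂ (CMHopf n ⊗[ℂ] CMHopf n) :=
  Algebra.adjoin ℂ ((fun a : CMHopf n => a ⊗ₜ[ℂ] (1 : CMHopf n)) '' FN n ∪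
    (fun a : CMHopf n => (1 : CMHopf n) ⊗ₜ[ℂ] a) '' FN n)

theorem inl_mem {a : CMHopf n} (ha : a ∈ FN n) : a ⊗ₜ[ℂ] (1 : CMHopf n) ∈ FN2 n :=
  Algebra.subset_adjoin (Or.inl ⟨a, ha, rfl⟩)

theorem inr_mem {a : CMHopf n} (ha : a ∈ FN n) : (1 : CMHopf n) ⊗ₜ[ℂ] a ∈ FN2 n :=
  Algebra.subset_adjoin (Or.inr ⟨a, ha, rfl⟩)

theorem W_eq (k : Fin n) : W (fun i j k => (al2 i j k : CMHopf n) ⊗ₜ[ℂ] (1 : CMHopf n))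
    (fun i j => 1 ⊗ₜ[ℂ] Y i j) k = ∑ i, ∑ j, al2 i j k ⊗ₜ[ℂ] Y i j := by
  simp [W]

/-- The data of the comultiplication:
`Δ X_k = X_k ⊗ 1 + 1 ⊗ X_k + ∑ α^i_{jk} ⊗ Y_i^j`, and `Y_i^j`, `α^i_{jk}` are primitive. -/
noncomputable def comulData (n : ℕ) : LiftData n (CMHopf n ⊗[ℂ] CMHopf n) where
  x k := X k ⊗ₜ 1 + 1 ⊗ₜ X k + ∑ i, ∑ j, al2 i j k ⊗ₜ[ℂ] Y i j
  y i j := Y i j ⊗ₜ 1 + 1 ⊗ₜ Y i j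
  p i j k := al2 i j k ⊗ₜ 1 + 1 ⊗ₜ al2 i j k
  S := FN2 n
  xx k l := by
    simp only [← W_eq]
    have h1 : ∀ k l : Fin n, ⁅(1 : CMHopf n) ⊗ₜ[ℂ] (X k : CMHopf n),
        W (fun i j k => (al2 i j k : CMHopf n) ⊗ₜ[ℂ] (1 : CMHopf n)) (fun i j => 1 ⊗ₜ[ℂ] Y i j) l⁆
        = - ∑ i, al2 i k l ⊗ₜ X i := by
      intro k l
      simp only [W, lie_sum', lie_mul', inr_inl_lie, inr_lie, zero_mul, zero_add,
        lie_swap' (X _) (Y _ _), Y_X, TensorProduct.tmul_neg, tmul_ite', mul_neg, mul_ite, mul_zero,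
        Finset.sum_neg_distrib, Finset.sum_ite_eq', Finset.mem_univ, if_true]
      simp
    have h2 : ∀ k l : Fin n, ⁅(X k : CMHopf n) ⊗ₜ[ℂ] (1 : CMHopf n),
        W (fun i j k => (al2 i j k : CMHopf n) ⊗ₜ[ℂ] (1 : CMHopf n)) (fun i j => 1 ⊗ₜ[ℂ] Y i j) l⁆
        = ∑ i, ∑ j, ⁅X k, al2 i j l⁆ ⊗ₜ Y i j := by
      intro k l
      simp only [W, lie_sum', lie_mul', inl_lie, inl_inr_lie, mul_zero, add_zero]
      simp
    have h3 := W_W_comul (fun i j k => (al2 i j k : CMHopf n) ⊗ₜ[ℂ] (1 : CMHopf n))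
      (fun i j => (1 : CMHopf n) ⊗ₜ[ℂ] (Y i j : CMHopf n))
      (by intros; simp [inl_lie, al2_al2]) (by intros; simp [inr_inl_lie])
      (by intros; simp [inr_lie, Y_Y, TensorProduct.tmul_sub, tmul_ite']) k l
    simp only [add_lie', lie_add', h3, inl_lie, inr_lie, X_X, inl_inr_lie, inr_inl_lie, h1, h2,
      TensorProduct.zero_tmul, TensorProduct.tmul_zero]
    rw [lie_swap' _ ((X l : CMHopf n) ⊗ₜ[ℂ] (1 : CMHopf n)),
      lie_swap' _ ((1 : CMHopf n) ⊗ₜ[ℂ] (X l : CMHopf n)), h1, h2]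
    have h4 : ∑ i, ∑ j, ⁅X k, al2 i j l⁆ ⊗ₜ[ℂ] (Y i j : CMHopf n)
        - ∑ i, ∑ j, ⁅X l, al2 i j k⁆ ⊗ₜ[ℂ] (Y i j : CMHopf n)
        = - ∑ i, ∑ j, (∑ t, (al2 i t k : CMHopf n) ⊗ₜ[ℂ] (1 : CMHopf n) * al2 t j l ⊗ₜ[ℂ] 1
          - ∑ t, (al2 i t l : CMHopf n) ⊗ₜ[ℂ] (1 : CMHopf n) * al2 t j k ⊗ₜ[ℂ] 1) *
          (1 : CMHopf n) ⊗ₜ[ℂ] (Y i j : CMHopf n) := by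
      simp only [← Finset.sum_sub_distrib, ← TensorProduct.sub_tmul, X_al2, ← Finset.sum_neg_distrib]
      refine Finset.sum_congr rfl fun i _ => Finset.sum_congr rfl fun j _ => ?_
      simp [TensorProduct.sub_tmul, TensorProduct.sum_tmul, sub_mul, Finset.sum_mul]
    have h5 : ∑ i, (al2 i l k : CMHopf n) ⊗ₜ[ℂ] (X i : CMHopf n) = ∑ i, al2 i k l ⊗ₜ X i :=
      Finset.sum_congr rfl fun i _ => by rw [al2_symm]
    rw [h5]
    refine Eq.trans ?_ (eq_neg_iff_add_eq_zero.1 h4)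
    abel
  yy i j k l := by
    simp only [lie_add', add_lie', inl_lie, inr_lie, inl_inr_lie, inr_inl_lie, Y_Y,
      TensorProduct.tmul_sub, TensorProduct.sub_tmul, tmul_ite', ite_tmul']
    split_ifs <;> abel
  yx i j k := by
    simp only [← W_eq]
    rw [lie_add', lie_W _ _ _ i j]
    · simp only [lie_add', add_lie', inl_lie, inr_lie, inl_inr_lie, inr_inl_lie, Y_X,
        tmul_ite', ite_tmul']
      split_ifs <;> abel
    · intros
      simp only [add_lie', inl_lie, inr_inl_lie, Y_al2, TensorProduct.sub_tmul,
        TensorProduct.add_tmul, ite_tmul', add_zero]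
    · intros
      simp only [add_lie', inr_lie, inl_inr_lie, Y_Y, TensorProduct.tmul_sub, tmul_ite', zero_add]
  psymm i j k := by rw [al2_symm]
  yp a b i j k := by
    simp only [lie_add', add_lie', inl_lie, inr_lie, inl_inr_lie, inr_inl_lie, Y_al2,
      TensorProduct.tmul_sub, TensorProduct.sub_tmul, TensorProduct.tmul_add,
      TensorProduct.add_tmul, tmul_ite', ite_tmul']
    split_ifs <;> abel
  bianchi i s k m := by
    simp only [← W_eq]
    have h1 : ∀ i j k m, ⁅W (fun i j k => (al2 i j k : CMHopf n) ⊗ₜ[ℂ] (1 : CMHopf n))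
        (fun i j => 1 ⊗ₜ[ℂ] Y i j) m, (al2 i j k : CMHopf n) ⊗ₜ[ℂ] (1 : CMHopf n)⁆ = 0 := by
      intros
      simp only [W, sum_lie', mul_lie', inl_lie, inr_inl_lie, al2_al2, TensorProduct.zero_tmul,
        mul_zero, zero_mul, add_zero, Finset.sum_const_zero]
    have h2 : ∀ m i s k, ⁅W (fun i j k => (al2 i j k : CMHopf n) ⊗ₜ[ℂ] (1 : CMHopf n))
        (fun i j => 1 ⊗ₜ[ℂ] Y i j) m, (1 : CMHopf n) ⊗ₜ[ℂ] (al2 i s k : CMHopf n)⁆ = _ :=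
      fun m i s k => W_lie _ (fun i j k => (1 : CMHopf n) ⊗ₜ[ℂ] (al2 i j k : CMHopf n)) _
        (by intros; exact inl_inr_lie ..)
        (by
          intros
          simp only [inr_lie, Y_al2, TensorProduct.tmul_sub, TensorProduct.tmul_add, tmul_ite'])
        m i s k
    simp only [lie_add', add_lie', inl_lie, inr_lie, inl_inr_lie, inr_inl_lie, h1, h2]
    have h3 := congrArg (fun a => a ⊗ₜ[ℂ] (1 : CMHopf n)) (X_al2 i s k m)
    have h4 := congrArg (fun a => (1 : CMHopf n) ⊗ₜ[ℂ] a) (X_al2 i s k m)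
    simp only [TensorProduct.sub_tmul, TensorProduct.tmul_sub, TensorProduct.sum_tmul,
      TensorProduct.tmul_sum] at h3 h4
    simp only [mul_add, add_mul, Finset.sum_add_distrib, Algebra.TensorProduct.tmul_mul_tmul,
      mul_one, one_mul, al2_symm _ m k] at h3 h4 ⊢
    rw [sub_eq_iff_eq_add] at h3 h4
    rw [h3, h4]
    abel
  S_comm := by
    refine adjoin_comm _ ?_
    rintro _ (⟨a, ha, rfl⟩ | ⟨a, ha, rfl⟩) _ (⟨b, hb, rfl⟩ | ⟨b, hb, rfl⟩)
    · simp [FN_comm a ha b hb]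
    · simp
    · simp
    · simp [FN_comm a ha b hb]
  p_mem i j k := add_mem (inl_mem (al_mem _ _)) (inr_mem (al_mem _ _))
  x_mem k := by
    refine adjoin_lie _ _ ?_
    simp only [← W_eq]
    rintro _ (⟨a, ha, rfl⟩ | ⟨a, ha, rfl⟩)
    · simp only [W, add_lie', inl_lie, inr_inl_lie, sum_lie', mul_lie']
      refine add_mem (add_mem (inl_mem (X_lie_mem k a ha)) (zero_mem _)) ?_
      refine sum_mem fun i _ => sum_mem fun j _ => ?_
      have : ⁅(al2 i j k : CMHopf n), a⁆ = 0 := sub_eq_zero.2 (FN_comm _ (al_mem _ _) _ ha)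
      rw [this]
      simp
    · simp only [W, add_lie', inl_inr_lie, inr_lie, sum_lie', mul_lie', zero_mul, zero_add]
      refine add_mem (inr_mem (X_lie_mem k a ha)) ?_
      exact sum_mem fun i _ => sum_mem fun j _ =>
        mul_mem (inl_mem (al_mem _ _)) (inr_mem (Y_lie_mem i j a ha))

/-- The comultiplication. -/
noncomputable def comul (n : ℕ) : CMHopf n →ₐ[ℂ] CMHopf n ⊗[ℂ] CMHopf n := (comulData n).lift

end comulData

section values

variable {n : ℕ}

@[simp] theorem counit_X (k : Fin n) : counit n (X k) = 0 := (charData n 0).lift_X k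

@[simp] theorem counit_Y (i j : Fin n) : counit n (Y i j) = 0 := by
  rw [counit, LiftData.lift_Y]; simp [charData]

@[simp] theorem counit_al2 (i j k : Fin n) : counit n (al2 i j k) = 0 :=
  (charData n 0).lift_al2 i j k

@[simp] theorem modularChar_X (k : Fin n) : modularChar n (X k) = 0 := (charData n 1).lift_X k

@[simp] theorem modularChar_Y (i j : Fin n) : modularChar n (Y i j) = if i = j then 1 else 0 :=
  (charData n 1).lift_Y i j

@[simp] theorem modularChar_al2 (i j k : Fin n) : modularChar n (al2 i j k) = 0 :=
  (charData n 1).lift_al2 i j k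

@[simp] theorem comul_X (k : Fin n) : comul n (X k) =
    X k ⊗ₜ 1 + 1 ⊗ₜ X k + ∑ i, ∑ j, al2 i j k ⊗ₜ[ℂ] Y i j :=
  (comulData n).lift_X k

@[simp] theorem comul_Y (i j : Fin n) : comul n (Y i j) = Y i j ⊗ₜ 1 + 1 ⊗ₜ Y i j :=
  (comulData n).lift_Y i j

@[simp] theorem comul_al2 (i j k : Fin n) : comul n (al2 i j k) =
    al2 i j k ⊗ₜ 1 + 1 ⊗ₜ al2 i j k :=
  (comulData n).lift_al2 i j k

end values

noncomputable instance (n : ℕ) : Bialgebra ℂ (CMHopf n) :=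
  Bialgebra.ofAlgHom (comul n) (counit n)
    (hom_ext
      (fun k => by
        simp [TensorProduct.add_tmul, TensorProduct.tmul_add, TensorProduct.sum_tmul,
          TensorProduct.tmul_sum, Algebra.TensorProduct.one_def, Finset.sum_add_distrib]
        abel)
      (fun i j => by
        simp [TensorProduct.add_tmul, TensorProduct.tmul_add, Algebra.TensorProduct.one_def]
        abel)
      (fun i j k => by
        simp [TensorProduct.add_tmul, TensorProduct.tmul_add, Algebra.TensorProduct.one_def]
        abel))
    (hom_ext (fun k => by simp) (fun i j => by simp) (fun i j k => by simp))
    (hom_ext (fun k => by simp) (fun i j => by simp) (fun i j k => by simp))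

end CM

namespace CM

section antipode

variable {n : ℕ}

theorem op_lie (a b : CMHopf n) : ⁅MulOpposite.op a, MulOpposite.op b⁆ =
    MulOpposite.op ⁅b, a⁆ := rfl

theorem op_ite (P : Prop) [Decidable P] (a : CMHopf n) :
    (if P then MulOpposite.op a else 0) = MulOpposite.op (if P then a else 0) := by
  split_ifs <;> rfl

theorem op_sum' (f : Fin n → CMHopf n) :
    ∑ t, MulOpposite.op (f t) = MulOpposite.op (∑ t, f t) := by
  simp

/-- The element `∑ α^i_{jk} Y_i^j`. -/
noncomputable def WH (k : Fin n) : CMHopf n := W al2 Y k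

theorem Y_WH (p q k : Fin n) : ⁅(Y p q : CMHopf n), WH k⁆ = if q = k then WH p else 0 :=
  lie_W al2 Y _ p q (Y_al2 p q) (Y_Y p q) k

theorem WH_al2 (m i s k : Fin n) : ⁅(WH m : CMHopf n), al2 i s k⁆ =
    ∑ t, al2 t s m * al2 i t k + ∑ t, al2 t k m * al2 i s t - ∑ t, al2 i t m * al2 t s k :=
  W_lie al2 al2 Y al2_al2 Y_al2 m i s k

theorem al2_comm (i j k i' j' k' : Fin n) :
    (al2 i j k : CMHopf n) * al2 i' j' k' = al2 i' j' k' * al2 i j k := al_al _ _ _ _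

/-- The data of the antipode:
`S X_k = - X_k + ∑ α^i_{jk} Y_i^j`, `S Y_i^j = - Y_i^j` and `S α^i_{jk} = - α^i_{jk}`. -/
noncomputable def antipodeData (n : ℕ) : LiftData n (CMHopf n)ᵐᵒᵖ where
  x k := MulOpposite.op (-X k + ∑ i, ∑ j, al2 i j k * Y i j)
  y i j := MulOpposite.op (-Y i j)
  p i j k := MulOpposite.op (-al2 i j k)
  S := (FN n).op
  xx k l := by
    change ⁅MulOpposite.op (-X k + WH k), MulOpposite.op (-X l + WH l)⁆ = 0
    have h1 : ∀ k l : Fin n, ⁅(X k : CMHopf n), WH l⁆ =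
        ∑ i, ∑ j, ⁅(X k : CMHopf n), al2 i j l⁆ * Y i j - ∑ i, al2 i k l * X i := by
      intro k l
      simp only [WH, W, lie_sum', lie_mul', lie_swap' (X _) (Y _ _), Y_X, mul_neg, mul_ite,
        mul_zero, Finset.sum_add_distrib, Finset.sum_neg_distrib, Finset.sum_ite_eq',
        Finset.mem_univ, if_true]
      abel
    have h2 : ⁅(WH l : CMHopf n), WH k⁆ = _ :=
      W_W_antipode al2 Y al2_al2 al2_symm Y_al2 Y_Y l k
    have h3 : ∑ i, (al2 i l k : CMHopf n) * X i = ∑ i, al2 i k l * X i :=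
      Finset.sum_congr rfl fun i _ => by rw [al2_symm]
    have h4 : ∑ i, ∑ j, ⁅(X k : CMHopf n), al2 i j l⁆ * Y i j
        - ∑ i, ∑ j, ⁅(X l : CMHopf n), al2 i j k⁆ * Y i j =
        - ∑ i, ∑ j, (∑ t, al2 i t k * al2 t j l - ∑ t, al2 i t l * al2 t j k) * Y i j := by
      simp only [← Finset.sum_sub_distrib, ← sub_mul, X_al2, ← Finset.sum_neg_distrib]
      refine Finset.sum_congr rfl fun i _ => Finset.sum_congr rfl fun j _ => ?_
      rw [← neg_mul]
      simp only [Finset.sum_sub_distrib]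
      congr 1
      abel
    rw [op_lie, MulOpposite.op_eq_zero_iff]
    simp only [lie_add', add_lie', lie_neg', neg_lie', X_X, h2]
    rw [lie_swap' (WH l) (X k), h1, h1, h3]
    refine Eq.trans ?_ (eq_neg_iff_add_eq_zero.1 h4)
    abel
  yy i j k l := by
    simp only [op_lie, lie_neg', neg_lie', neg_neg, op_ite]
    rw [lie_swap', Y_Y, ← MulOpposite.op_sub]
    congr 1
    split_ifs <;> abel
  yx i j k := by
    change ⁅MulOpposite.op (-Y i j), MulOpposite.op (-X k + WH k)⁆ = if j = k then
      MulOpposite.op (-X i + WH i) else 0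
    rw [op_lie, op_ite]
    congr 1
    rw [lie_neg', lie_swap', neg_neg, lie_add', lie_neg', Y_X, Y_WH]
    split_ifs <;> simp
  psymm i j k := by rw [al2_symm]
  yp a b i j k := by
    simp only [op_lie, lie_neg', neg_lie', neg_neg, op_ite, ← MulOpposite.op_sub,
      ← MulOpposite.op_add]
    congr 1
    rw [lie_swap', Y_al2]
    split_ifs <;> abel
  bianchi i s k m := by
    change ⁅MulOpposite.op (-X m + WH m), _⁆ - ⁅MulOpposite.op (-X k + WH k), _⁆ = _
    simp only [op_lie, ← MulOpposite.op_mul, op_sum', ← MulOpposite.op_sub]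
    congr 1
    rw [lie_swap', lie_swap' _ (-X k + WH k)]
    simp only [lie_neg', add_lie', neg_lie', WH_al2, neg_mul_neg, neg_neg]
    have h1 := X_al2 i s k m
    rw [sub_eq_iff_eq_add] at h1
    rw [h1]
    have h2 : ∀ k m, ∑ t, (al2 t s m : CMHopf n) * al2 i t k = ∑ t, al2 i t k * al2 t s m :=
      fun k m => Finset.sum_congr rfl fun _ _ => al2_comm ..
    have h3 : ∑ t, (al2 t k m : CMHopf n) * al2 i s t = ∑ t, al2 t m k * al2 i s t :=
      Finset.sum_congr rfl fun t _ => by rw [al2_symm t]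
    simp only [h2, h3]
    abel
  S_comm a ha b hb := by
    apply MulOpposite.unop_injective
    exact FN_comm _ hb _ ha
  p_mem i j k := neg_mem (al_mem _ _)
  x_mem k a ha := by
    obtain ⟨a, rfl⟩ := MulOpposite.op_surjective a
    have ha : a ∈ FN n := ha
    change ⁅a, -X k + WH k⁆ ∈ FN n
    rw [lie_swap', add_lie', neg_lie']
    refine neg_mem (add_mem (neg_mem (X_lie_mem k a ha)) ?_)
    rw [WH, W]
    simp only [sum_lie', mul_lie']
    refine sum_mem fun i _ => sum_mem fun j _ => ?_
    have h : ⁅(al2 i j k : CMHopf n), a⁆ = 0 := sub_eq_zero.2 (FN_comm _ (al_mem _ _) _ ha)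
    rw [h, zero_mul, zero_add]
    exact mul_mem (al_mem _ _) (Y_lie_mem i j a ha)

/-- The antipode, as an algebra map to the opposite algebra. -/
noncomputable def antipodeOp (n : ℕ) : CMHopf n →ₐ[ℂ] (CMHopf n)ᵐᵒᵖ := (antipodeData n).lift

/-- The antipode. -/
noncomputable def antipode (n : ℕ) : CMHopf n →ₗ[ℂ] CMHopf n :=
  (MulOpposite.opLinearEquiv ℂ).symm.toLinearMap ∘ₗ (antipodeOp n).toLinearMap

theorem antipode_mul (a b : CMHopf n) : antipode n (a * b) = antipode n b * antipode n a := by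
  simp [antipode]

theorem antipode_algebraMap (r : ℂ) : antipode n (algebraMap ℂ _ r) = algebraMap ℂ _ r := by
  simp [antipode]

@[simp] theorem antipode_X (k : Fin n) :
    antipode n (X k) = -X k + ∑ i, ∑ j, al2 i j k * Y i j := by
  change MulOpposite.unop ((antipodeData n).lift _) = _
  rw [LiftData.lift_X]; rfl

@[simp] theorem antipode_Y (i j : Fin n) : antipode n (Y i j) = -Y i j := by
  change MulOpposite.unop ((antipodeData n).lift _) = _
  rw [LiftData.lift_Y]; rfl

@[simp] theorem antipode_al2 (i j k : Fin n) : antipode n (al2 i j k) = -al2 i j k := by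
  change MulOpposite.unop ((antipodeData n).lift (al i {j, k})) = _
  rw [LiftData.lift_al2]; rfl

theorem conv_left_mul (a : CMHopf n) (u v : CMHopf n ⊗[ℂ] CMHopf n)
    (hu : LinearMap.mul' ℂ (CMHopf n) ((antipode n).rTensor _ u) = a) (ha : ∀ b, a * b = b * a) :
    LinearMap.mul' ℂ (CMHopf n) ((antipode n).rTensor _ (u * v)) =
      a * LinearMap.mul' ℂ (CMHopf n) ((antipode n).rTensor _ v) := by
  induction v using TensorProduct.induction_on with
  | zero => simp
  | add v w hv hw => rw [mul_add, map_add, map_add, hv, hw, map_add, map_add, mul_add]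
  | tmul c d =>
    have h : ∀ u : CMHopf n ⊗[ℂ] CMHopf n,
        LinearMap.mul' ℂ (CMHopf n) ((antipode n).rTensor _ (u * c ⊗ₜ d)) =
        antipode n c * LinearMap.mul' ℂ (CMHopf n) ((antipode n).rTensor _ u) * d := by
      intro u
      induction u using TensorProduct.induction_on with
      | zero => simp
      | add v w hv hw => rw [add_mul, map_add, map_add, hv, hw, map_add, map_add, mul_add, add_mul]
      | tmul e f => simp [antipode_mul, mul_assoc]
    rw [h, hu, ← ha]
    simp [mul_assoc]

theorem conv_right_mul (a : CMHopf n) (u v : CMHopf n ⊗[ℂ] CMHopf n)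
    (hv : LinearMap.mul' ℂ (CMHopf n) ((antipode n).lTensor _ v) = a) (ha : ∀ b, a * b = b * a) :
    LinearMap.mul' ℂ (CMHopf n) ((antipode n).lTensor _ (u * v)) =
      LinearMap.mul' ℂ (CMHopf n) ((antipode n).lTensor _ u) * a := by
  induction u using TensorProduct.induction_on with
  | zero => simp
  | add u w hu hw => rw [add_mul, map_add, map_add, hu, hw, map_add, map_add, add_mul]
  | tmul c d =>
    have h : ∀ v : CMHopf n ⊗[ℂ] CMHopf n,
        LinearMap.mul' ℂ (CMHopf n) ((antipode n).lTensor _ (c ⊗ₜ d * v)) =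
        c * LinearMap.mul' ℂ (CMHopf n) ((antipode n).lTensor _ v) * antipode n d := by
      intro v
      induction v using TensorProduct.induction_on with
      | zero => simp
      | add v w hv hw => rw [mul_add, map_add, map_add, hv, hw, map_add, map_add, mul_add, add_mul]
      | tmul e f => simp [antipode_mul, mul_assoc]
    rw [h, hv, mul_assoc, ha]
    simp [mul_assoc]

/-- The elements on which both antipode axioms hold form a subalgebra. -/
noncomputable def antipodeSub (n : ℕ) : Subalgebra ℂ (CMHopf n) where
  carrier := {h | LinearMap.mul' ℂ (CMHopf n) ((antipode n).rTensor _ (comul n h)) =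
      algebraMap ℂ _ (counit n h) ∧
    LinearMap.mul' ℂ (CMHopf n) ((antipode n).lTensor _ (comul n h)) =
      algebraMap ℂ _ (counit n h)}
  mul_mem' := by
    rintro a b ⟨ha, ha'⟩ ⟨hb, hb'⟩
    refine ⟨?_, ?_⟩
    · rw [map_mul, conv_left_mul _ _ _ ha (fun b => Algebra.commutes _ b), hb, map_mul, map_mul]
    · rw [map_mul, conv_right_mul _ _ _ hb' (fun b => Algebra.commutes _ b), ha', map_mul,
        map_mul]
  add_mem' := by
    rintro a b ⟨ha, ha'⟩ ⟨hb, hb'⟩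
    exact ⟨by simp only [map_add, ha, hb], by simp only [map_add, ha', hb']⟩
  algebraMap_mem' r := by
    refine ⟨?_, ?_⟩
    · rw [AlgHom.commutes, AlgHom.commutes, Algebra.TensorProduct.algebraMap_apply]
      simp [antipode_algebraMap, -Algebra.TensorProduct.algebraMap_apply]
    · rw [AlgHom.commutes, AlgHom.commutes, Algebra.TensorProduct.algebraMap_apply]
      have : antipode n 1 = 1 := by simpa using antipode_algebraMap (n := n) 1
      simp [this]

theorem antipode_axioms (h : CMHopf n) : h ∈ antipodeSub n := by
  refine generated _ (fun k => ?_) (fun i j => ?_) (fun i j k => ?_) h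
  all_goals
    have h1 : antipode n 1 = 1 := by simpa using antipode_algebraMap (n := n) 1
    constructor <;> simp [h1]

end antipode

noncomputable instance (n : ℕ) : HopfAlgebra ℂ (CMHopf n) where
  antipode := antipode n
  mul_antipode_rTensor_comul := LinearMap.ext fun h => (antipode_axioms h).1
  mul_antipode_lTensor_comul := LinearMap.ext fun h => (antipode_axioms h).2

end CM

section AYD

universe u v w

/-- A right action and a left coaction of `H` on `V`, without any axioms:
`act v h` is `v · h` and `coact v` is `v₍₋₁₎ ⊗ v₍₀₎`. -/
structure ActCoact (H : Type u) (V : Type v) [Ring H] [Algebra ℂ H] [AddCommGroup V]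
    [Module ℂ V] where
  act : V →ₗ[ℂ] H →ₗ[ℂ] V
  coact : V →ₗ[ℂ] H ⊗[ℂ] V

namespace ActCoact

variable {H : Type u} {V : Type v} {W : Type w} [Ring H] [HopfAlgebra ℂ H] [AddCommGroup V]
  [Module ℂ V] [AddCommGroup W] [Module ℂ W]

/-- For `a, b, c` in `H`, the map `x ⊗ v ↦ S(c) x a ⊗ v · b`. -/
noncomputable def twist (M : ActCoact H V) (a b c : H) : H ⊗[ℂ] V →ₗ[ℂ] H ⊗[ℂ] V :=
  TensorProduct.map
    (LinearMap.mulLeft ℂ (HopfAlgebra.antipode ℂ c) ∘ₗ LinearMap.mulRight ℂ a) (M.act.flip b)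

/-- `M` is a right-left anti-Yetter-Drinfeld module: a right `H`-module and a left `H`-comodule
such that `(v · h)₍₋₁₎ ⊗ (v · h)₍₀₎ = S(h₍₃₎) v₍₋₁₎ h₍₁₎ ⊗ v₍₀₎ · h₍₂₎`. In the last field
`∑ a r ⊗ (b r ⊗ c r)` is an arbitrary expression of `h₍₁₎ ⊗ (h₍₂₎ ⊗ h₍₃₎)` as a finite sum of
elementary tensors. -/
structure IsAYD (M : ActCoact H V) : Prop where
  act_one : ∀ v, M.act v 1 = v
  act_mul : ∀ v h k, M.act v (h * k) = M.act (M.act v h) k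
  counit_coact : ∀ v,
    TensorProduct.lid ℂ V ((Coalgebra.counit (R := ℂ) (A := H)).rTensor V (M.coact v)) = v
  coassoc : ∀ v, TensorProduct.assoc ℂ H H V
      ((Coalgebra.comul (R := ℂ) (A := H)).rTensor V (M.coact v)) =
    M.coact.lTensor H (M.coact v)
  ayd : ∀ (v : V) (h : H) (m : ℕ) (a b c : Fin m → H),
    (Coalgebra.comul (R := ℂ) (A := H)).lTensor H (Coalgebra.comul (R := ℂ) h) =
      ∑ r, a r ⊗ₜ[ℂ] (b r ⊗ₜ[ℂ] c r) →
    M.coact (M.act v h) = ∑ r, M.twist (a r) (b r) (c r) (M.coact v)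

/-- Isomorphisms: linear bijections that are `H`-linear and `H`-colinear. -/
structure Iso (M : ActCoact H V) (N : ActCoact H W) where
  toEquiv : V ≃ₗ[ℂ] W
  map_act : ∀ v h, toEquiv (M.act v h) = N.act (toEquiv v) h
  map_coact : ∀ v, N.coact (toEquiv v) = toEquiv.toLinearMap.lTensor H (M.coact v)

/-- The direct sum of `d` copies of `M`. -/
noncomputable def copies (M : ActCoact H V) (d : ℕ) : ActCoact H (Fin d → V) where
  act := LinearMap.mk₂ ℂ (fun f h i => M.act (f i) h)
    (fun f g h => by ext i; simp) (fun c f h => by ext i; simp)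
    (fun f h k => by ext i; simp) (fun c f h => by ext i; simp)
  coact := ∑ i, (LinearMap.single ℂ (fun _ : Fin d => V) i).lTensor H ∘ₗ M.coact ∘ₗ
    LinearMap.proj i

/-- The one-dimensional space `ℂ` with the right action through the character `χ` and the
trivial coaction `z ↦ 1 ⊗ z`. -/
noncomputable def ofChar (χ : H →ₐ[ℂ] ℂ) : ActCoact H ℂ where
  act := (LinearMap.mul ℂ ℂ).compl₂ χ.toLinearMap
  coact := TensorProduct.mk ℂ H ℂ 1

end ActCoact

/-- The module `C_δ` over the Connes-Moscovici Hopf algebra. -/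
noncomputable def CM.Cdelta (n : ℕ) : ActCoact (CMHopf n) ℂ :=
  ActCoact.ofChar (CM.modularChar n)

end AYD

/-! Write `g` for `gl(n)^aff` and consider the matrix coefficients `v₍₋₁₎ f(v₍₀₎) ∈ H` of the
coaction (`coef f v`). Pairing the anti-Yetter–Drinfeld condition with `f` turns it into identities
inside `H` between these coefficients, and the theorem is read off from the identities for the
generators.

That `C_δ` qualifies amounts to `S(h₍₃₎) δ(h₍₂₎) h₍₁₎ = δ(h)`. This condition is stable under
products, so only generators matter. For `X_k` the reordering of `α^i_{jk} Y_i^j` produces the trace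
`∑ α^i_{ik}` (`sum_Y_al2`), which the values `δ(Y_i^j)` compensate exactly.

The action is forced by a bounded-order argument. `H` acts on the right on the jet algebra, `g` by
derivations and `F(N)` by multiplication; `h ↦ 1 · h` is a projection to jets that kills `gH`. For
`X_k - ∑ α^i_{ik}` the projected identity (`jetCoef_act_X`) involves only jets of coefficients, the
derivation `dX k` and the variables `α^i_{jk}`. Since `V` is finite-dimensional, all jets of
coefficients have bounded order, whereas `dX k` raises the order by one (`jetDeriv_dX`). Descending
on the order, the jets are the constants `f(v)`. Comparing the coefficients of `α^i_{jk}` then shows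
that `Y_i^j` acts by the Kronecker symbol (`act_Y_eq`). As `X_k` and `α^i_{jk}` are sums of
commutators with the diagonal `Y_p^p`, they act by zero.

Once the action is `δ`, the same identities say that the matrix coefficients commute with all
`Y_i^j` and `X_k` (`coef_commute`). Commuting with `∑ Y_p^p` puts them in degree zero, that is, in
the subalgebra generated by `gl(n)`. Commuting with the translations makes the standard
representation of `gl(n)` agree with the counit on them (`stdDiff_eq_zero`). By coassociativity the
contraction of a coefficient with the difference of these two representations vanishes as well. On
the algebra generated by `gl(n)` such contractions behave like partial derivatives to leading order,
so an Euler operator built from them detects word length (`spanY_pow_le_countSub`), and the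
coefficients are scalars (`scalar_of_contract`). The coaction is therefore trivial. -/

namespace CM

/-- The variables `α^i_J` with `|J| ≥ 2`. -/
abbrev JetVar (n : ℕ) : Type := Fin n × {J : Multiset (Fin n) // 2 ≤ J.card}

/-- The polynomial algebra in the Taylor coefficients `α^i_J`, `|J| ≥ 2`. -/
abbrev Jets (n : ℕ) : Type := MvPolynomial (JetVar n) ℂ

/-! ### The jet algebra and the derivations by which `gl(n)^aff` acts on it -/

namespace Jets

variable {n : ℕ}

/-- The Taylor coefficient `α^i_J` as a polynomial. -/
noncomputable def a (i : Fin n) (J : Multiset (Fin n)) : Jets n :=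
  if h : 2 ≤ J.card then MvPolynomial.X (i, ⟨J, h⟩) else if J = {i} then 1 else 0

theorem a_var (w : JetVar n) : a w.1 w.2.1 = MvPolynomial.X w := by
  rw [a, dif_pos w.2.2]

theorem a_zero (i : Fin n) : a i 0 = 0 := by
  rw [a, dif_neg (by simp), if_neg (by simp)]

theorem a_one (i j : Fin n) : a i {j} = if i = j then 1 else 0 := by
  rw [a, dif_neg (by simp)]
  simp [eq_comm]

/-- The derivation of the jet algebra given by the action of `X_k`. -/
noncomputable def dX (k : Fin n) : Derivation ℂ (Jets n) (Jets n) :=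
  MvPolynomial.mkDerivation ℂ fun w => a w.1 (k ::ₘ w.2.1) - ∑ s, a w.1 {s, k} * a s w.2.1

/-- The derivation of the jet algebra given by the action of `Y_p^q`. -/
noncomputable def dY (p q : Fin n) : Derivation ℂ (Jets n) (Jets n) :=
  MvPolynomial.mkDerivation ℂ fun w => w.2.1.count q • a w.1 (p ::ₘ w.2.1.erase q) -
    (if w.1 = p then a q w.2.1 else 0)

theorem derivation_a_one (D : Derivation ℂ (Jets n) (Jets n)) (i j : Fin n) : D (a i {j}) = 0 := by
  rw [a_one]; split_ifs <;> simp

theorem derivation_ite (P : Prop) [Decidable P] (D : Derivation ℂ (Jets n) (Jets n))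
    (f : Jets n) : D (if P then f else 0) = if P then D f else 0 := by
  split_ifs <;> simp

theorem ite_derivation_apply (P : Prop) [Decidable P] (D : Derivation ℂ (Jets n) (Jets n))
    (f : Jets n) : (if P then D else 0) f = if P then D f else 0 := by
  split_ifs <;> simp

theorem eq_of_card {J : Multiset (Fin n)} (h : ¬ 2 ≤ J.card) (h0 : J ≠ 0) : ∃ j, J = {j} := by
  rw [← Multiset.card_eq_one]
  have := Multiset.card_pos.2 h0
  omega

theorem dX_a (k i : Fin n) (J : Multiset (Fin n)) (hJ : J ≠ 0) :
    dX k (a i J) = a i (k ::ₘ J) - ∑ s, a i {s, k} * a s J := by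
  by_cases h : 2 ≤ J.card
  · rw [a_var (i, ⟨J, h⟩), dX, MvPolynomial.mkDerivation_X]
  · obtain ⟨j, rfl⟩ := eq_of_card h hJ
    rw [derivation_a_one]
    simp only [a_one, mul_ite, mul_one, mul_zero, Finset.sum_ite_eq', Finset.mem_univ, if_true]
    rw [Multiset.pair_comm]
    exact (sub_self _).symm

theorem dY_a (p q i : Fin n) (J : Multiset (Fin n)) :
    dY p q (a i J) = J.count q • a i (p ::ₘ J.erase q) - (if i = p then a q J else 0) := by
  by_cases h : 2 ≤ J.card
  · rw [a_var (i, ⟨J, h⟩), dY, MvPolynomial.mkDerivation_X]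
  · by_cases hJ : J = 0
    · subst hJ; simp [a_zero]
    · obtain ⟨j, rfl⟩ := eq_of_card h hJ
      rw [derivation_a_one, a_one, Multiset.count_singleton]
      by_cases hq : q = j
      · subst hq; simp [a_one]
      · simp [hq]

theorem a_cons (k i : Fin n) (J : Multiset (Fin n)) (hJ : J ≠ 0) :
    a i (k ::ₘ J) = dX k (a i J) + ∑ s, a i {s, k} * a s J := by
  rw [dX_a k i J hJ]; ring

theorem dY_a2 (p q i j k : Fin n) : dY p q (a i {j, k}) =
    (if q = j then a i {p, k} else 0) + (if q = k then a i {j, p} else 0)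
      - (if i = p then a q {j, k} else 0) := by
  rw [dY_a]
  congr 1
  by_cases h1 : q = j
  · subst h1
    by_cases h2 : q = k
    · subst h2
      simp [Multiset.pair_comm q p, two_smul]
    · simp [h2]
  · by_cases h2 : q = k
    · subst h2
      have h3 : ({j, q} : Multiset (Fin n)).erase q = {j} := by
        rw [Multiset.pair_comm]; simp
      have h4 : ({j, q} : Multiset (Fin n)).count q = 1 := by
        rw [Multiset.insert_eq_cons, Multiset.count_cons_of_ne h1]; simp
      rw [h3, h4, one_smul, if_neg h1, if_pos rfl, zero_add, Multiset.pair_comm]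
      rfl
    · simp [h1, h2]

theorem hom_ext {D E : Derivation ℂ (Jets n) (Jets n)}
    (h : ∀ i J, 2 ≤ J.card → D (a i J) = E (a i J)) : D = E :=
  MvPolynomial.derivation_ext fun w => by rw [← a_var]; exact h _ _ w.2.2

/-- By `a_cons`, every Taylor coefficient is obtained from the second order ones by applying the `dX
k` and multiplying, so induction on the order applies. This reduces bracket identities to order two.
-/
theorem eq_of_a2 {D E : Derivation ℂ (Jets n) (Jets n)} (hX : ∀ k : Fin n, ⁅D, dX k⁆ = ⁅E, dX k⁆)
    (h2 : ∀ i j k, D (a i {j, k}) = E (a i {j, k})) : D = E := by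
  refine hom_ext fun i J _ => ?_
  induction J using Multiset.induction generalizing i with
  | empty => rw [a_zero, map_zero, map_zero]
  | cons k J ih =>
    by_cases hJ : J = 0
    · subst hJ
      exact (derivation_a_one D i k).trans (derivation_a_one E i k).symm
    have ih' : ∀ i, D (a i J) = E (a i J) := by
      intro i
      by_cases h : 2 ≤ J.card
      · exact ih i h
      · obtain ⟨j, rfl⟩ := eq_of_card h hJ
        rw [derivation_a_one, derivation_a_one]
    have h1 := congrArg (fun D => D (a i J)) (hX k)
    simp only [Derivation.commutator_apply, ih'] at h1
    rw [a_cons _ _ _ hJ]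
    simp only [map_add, map_sum, Derivation.leibniz, h2, ih', sub_left_inj.1 h1]

theorem dX_dX (k l : Fin n) : ⁅dX k, dX l⁆ = (0 : Derivation ℂ (Jets n) (Jets n)) := by
  refine hom_ext fun i J hJ => ?_
  have h0 : J ≠ 0 := by rintro rfl; simp at hJ
  -- The full expansion is symmetric in `k` and `l`: the second and third terms are exchanged, and
  -- so are the two double sums after renaming indices.
  have h1 : ∀ k l, dX k (dX l (a i J)) = a i (k ::ₘ l ::ₘ J) - ∑ s, a i {s, k} * a s (l ::ₘ J)
      - ∑ s, a i {s, l} * a s (k ::ₘ J) - ∑ s, a i (k ::ₘ s ::ₘ l ::ₘ 0) * a s J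
      + ∑ s, ∑ t, a i {t, k} * a t {s, l} * a s J
      + ∑ s, ∑ t, a i {s, l} * a s {t, k} * a t J := by
    intro k l
    rw [dX_a _ _ _ h0, map_sub, dX_a _ _ _ (by simp), map_sum]
    simp only [Derivation.leibniz, smul_eq_mul, dX_a _ _ _ h0]
    have h2 : ∀ s, dX k (a i {s, l}) = a i (k ::ₘ s ::ₘ l ::ₘ 0) - ∑ t, a i {t, k} * a t {s, l} :=
      fun s => dX_a _ _ _ (by simp)
    simp only [h2, mul_sub, sub_mul, Finset.sum_add_distrib, Finset.sum_sub_distrib,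
      Finset.mul_sum, mul_assoc, mul_comm (a _ J)]
    simp only [Finset.sum_mul, mul_assoc]
    ring
  rw [Derivation.commutator_apply, h1, h1, Multiset.cons_swap k l]
  have h3 : ∀ s, k ::ₘ s ::ₘ l ::ₘ 0 = l ::ₘ s ::ₘ k ::ₘ (0 : Multiset (Fin n)) := fun s => by
    rw [Multiset.cons_swap s l, Multiset.cons_swap s k, Multiset.cons_swap k l]
  simp only [h3]
  rw [Finset.sum_comm (f := fun s t => a i {t, k} * a t {s, l} * a s J),
    Finset.sum_comm (f := fun s t => a i {t, l} * a t {s, k} * a s J)]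
  simp only [Derivation.coe_zero, Pi.zero_apply]
  ring

theorem dY_dX (p q k : Fin n) : ⁅dY p q, dX k⁆ =
    if q = k then dX p else (0 : Derivation ℂ (Jets n) (Jets n)) := by
  refine hom_ext fun i J hJ => ?_
  have h0 : J ≠ 0 := by rintro rfl; simp at hJ
  -- The occurrence of `q` that is replaced by `p` is either the new entry `k` or one already in
  -- `J`. If `q` is absent from `J`, the zero multiplicity makes the value of `erase` irrelevant.
  have key : (k ::ₘ J).count q • a i (p ::ₘ (k ::ₘ J).erase q) =
      (if q = k then a i (p ::ₘ J) else 0) + J.count q • a i (k ::ₘ p ::ₘ J.erase q) := by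
    by_cases hq : q = k
    · subst hq
      rw [Multiset.count_cons_self, Multiset.erase_cons_head, if_pos rfl, add_smul, one_smul,
        add_comm]
      by_cases hm : q ∈ J
      · rw [Multiset.cons_swap, Multiset.cons_erase hm]
      · rw [Multiset.count_eq_zero_of_notMem hm]; simp
    · rw [Multiset.count_cons_of_ne hq, if_neg hq, zero_add,
        Multiset.erase_cons_tail _ (fun h => hq h.symm), Multiset.cons_swap]
  rw [Derivation.commutator_apply, dX_a _ _ _ h0, map_sub, map_sum, dY_a, dY_a, key]
  simp only [Derivation.leibniz, smul_eq_mul, dY_a2]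
  simp only [dY_a, map_sub, map_nsmul]
  rw [dX_a _ _ _ Multiset.cons_ne_zero]
  rw [ite_derivation_apply, dX_a _ _ _ h0]
  simp only [mul_sub, mul_add, mul_ite, mul_zero, mul_smul_comm, Finset.sum_add_distrib,
    Finset.sum_sub_distrib, Finset.sum_ite_eq, Finset.sum_ite_eq', Finset.mem_univ, if_true, sum_ite_const,
    smul_sub, Finset.smul_sum]
  split_ifs <;> simp only [dX_a _ _ _ h0, mul_comm (a _ J), map_zero] <;> ring

/-- By `eq_of_a2` it is enough to compare commutators with `dX k`, which are known from `dY_dX`, and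
values in order two. -/
theorem dY_dY (p q r t : Fin n) : ⁅dY p q, dY r t⁆ = (if q = r then dY p t else 0) -
    (if t = p then dY r q else (0 : Derivation ℂ (Jets n) (Jets n))) := by
  refine eq_of_a2 (fun k => ?_) fun i j k => ?_
  · ext1 w
    have h : ∀ (p q k : Fin n) (f : Jets n), dY p q (dX k f) =
        dX k (dY p q f) + if q = k then dX p f else 0 := by
      intro p q k f
      rw [← ite_derivation_apply, ← dY_dX, Derivation.commutator_apply]
      ring
    simp only [Derivation.commutator_apply, Derivation.sub_apply, ite_derivation_apply, h, map_sub, map_add, derivation_ite]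
    split_ifs <;> subst_vars <;> ring
  · rw [Derivation.commutator_apply, Derivation.sub_apply, ite_derivation_apply, ite_derivation_apply]
    simp only [dY_a2, map_add, map_sub, derivation_ite]
    split_ifs <;> subst_vars <;> ring

end Jets

end CM

/-! ### The right action of the Hopf algebra on jets and the projection `h ↦ 1 · h` -/

namespace CM

namespace Jets

variable {n : ℕ}

theorem sum_derivation_apply (D : Fin n → Derivation ℂ (Jets n) (Jets n)) (f : Jets n) :
    (∑ s, D s) f = ∑ s, D s f := by
  rw [← Finset.sum_apply f Finset.univ fun s => ⇑(D s)]
  exact congrFun (map_sum Derivation.coeFnAddMonoidHom D Finset.univ) f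

/-- Multiplication by `f`, in the opposite of the endomorphism algebra of the jet algebra. -/
noncomputable def opMul (f : Jets n) : (Module.End ℂ (Jets n))ᵐᵒᵖ :=
  MulOpposite.op (LinearMap.mulLeft ℂ f)

/-- The negative of a derivation, in the opposite of the endomorphism algebra. -/
noncomputable def opNeg (D : Derivation ℂ (Jets n) (Jets n)) : (Module.End ℂ (Jets n))ᵐᵒᵖ :=
  MulOpposite.op (-D.toLinearMap)

theorem opMul_mul (f g : Jets n) : opMul f * opMul g = opMul (f * g) := by
  refine MulOpposite.unop_injective (LinearMap.ext fun x => ?_)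
  simp [opMul, mul_left_comm]

theorem opMul_add (f g : Jets n) : opMul (f + g) = opMul f + opMul g := by
  refine MulOpposite.unop_injective (LinearMap.ext fun x => ?_)
  simp [opMul, add_mul]

theorem opMul_sub (f g : Jets n) : opMul (f - g) = opMul f - opMul g := by
  refine MulOpposite.unop_injective (LinearMap.ext fun x => ?_)
  simp [opMul, sub_mul]

theorem opMul_zero : opMul (0 : Jets n) = 0 := by
  refine MulOpposite.unop_injective (LinearMap.ext fun x => ?_)
  simp [opMul]

theorem opMul_ite (P : Prop) [Decidable P] (f : Jets n) :
    opMul (if P then f else 0) = if P then opMul f else 0 := by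
  split_ifs <;> simp [opMul_zero]

theorem opMul_sum (f : Fin n → Jets n) : opMul (∑ t, f t) = ∑ t, opMul (f t) := by
  refine MulOpposite.unop_injective (LinearMap.ext fun x => ?_)
  simp [opMul, Finset.sum_mul]

theorem opNeg_zero : opNeg (0 : Derivation ℂ (Jets n) (Jets n)) = 0 := by
  refine MulOpposite.unop_injective (LinearMap.ext fun x => ?_)
  simp [opNeg]

theorem opNeg_sub (D E : Derivation ℂ (Jets n) (Jets n)) :
    opNeg (D - E) = opNeg D - opNeg E := by
  refine MulOpposite.unop_injective (LinearMap.ext fun x => ?_)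
  simp [opNeg]
  ring

theorem opNeg_ite (P : Prop) [Decidable P] (D : Derivation ℂ (Jets n) (Jets n)) :
    opNeg (if P then D else 0) = if P then opNeg D else 0 := by
  split_ifs <;> simp [opNeg_zero]

/-- Passing to the opposite algebra reverses commutators, and the sign in `opNeg` undoes this. The
same sign makes `opNeg_opMul` come out as `D f`. -/
theorem opNeg_opNeg (D E : Derivation ℂ (Jets n) (Jets n)) : ⁅opNeg D, opNeg E⁆ = opNeg ⁅D, E⁆ := by
  refine MulOpposite.unop_injective (LinearMap.ext fun x => ?_)
  simp [opNeg, Ring.lie_def]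

theorem opNeg_opMul (D : Derivation ℂ (Jets n) (Jets n)) (f : Jets n) :
    ⁅opNeg D, opMul f⁆ = opMul (D f) := by
  refine MulOpposite.unop_injective (LinearMap.ext fun x => ?_)
  simp [opNeg, opMul, Ring.lie_def]
  ring

theorem opMul_apply (g f : Jets n) : (opMul g).unop f = f * g := mul_comm _ _

/-- The multiplication operators. -/
noncomputable def mulOps (n : ℕ) : Subalgebra ℂ (Module.End ℂ (Jets n))ᵐᵒᵖ where
  carrier := Set.range opMul
  mul_mem' := by
    rintro _ _ ⟨f, rfl⟩ ⟨g, rfl⟩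
    exact ⟨_, (opMul_mul f g).symm⟩
  add_mem' := by
    rintro _ _ ⟨f, rfl⟩ ⟨g, rfl⟩
    exact ⟨_, opMul_add f g⟩
  algebraMap_mem' r := by
    refine ⟨algebraMap ℂ _ r, ?_⟩
    refine MulOpposite.unop_injective (LinearMap.ext fun x => ?_)
    simp [opMul, Algebra.smul_def]

theorem dX_a2 (i s k m : Fin n) : dX m (a i {s, k}) - dX k (a i {s, m}) =
    ∑ t, a i {t, k} * a t {s, m} - ∑ t, a i {t, m} * a t {s, k} := by
  have h : (m ::ₘ {s, k} : Multiset (Fin n)) = k ::ₘ {s, m} := by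
    simp only [Multiset.insert_eq_cons, ← Multiset.cons_zero]
    rw [Multiset.cons_swap m s, Multiset.cons_swap k s, Multiset.cons_swap m k]
  rw [dX_a _ _ _ (by simp), dX_a _ _ _ (by simp), h]
  ring

/-- The data of the right action of the Connes-Moscovici algebra on the jet algebra, which is
its quotient by the right ideal generated by `g`. -/
noncomputable def actData (n : ℕ) : LiftData n (Module.End ℂ (Jets n))ᵐᵒᵖ where
  x k := opNeg (dX k)
  y i j := opNeg (dY i j)
  p i j k := opMul (a i {j, k})
  S := mulOps n
  xx k l := by rw [opNeg_opNeg, dX_dX, opNeg_zero]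
  yy i j k l := by rw [opNeg_opNeg, dY_dY, opNeg_sub, opNeg_ite, opNeg_ite]
  yx i j k := by rw [opNeg_opNeg, dY_dX, opNeg_ite]
  psymm i j k := by rw [Multiset.pair_comm]
  yp p q i j k := by
    rw [opNeg_opMul, dY_a2, opMul_sub, opMul_add, opMul_ite, opMul_ite, opMul_ite]
  bianchi i s k m := by
    simp only [opNeg_opMul, opMul_mul, ← opMul_sub, ← opMul_sum, dX_a2]
  S_comm := by
    rintro _ ⟨f, rfl⟩ _ ⟨g, rfl⟩
    rw [opMul_mul, opMul_mul, mul_comm]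
  p_mem i j k := ⟨_, rfl⟩
  x_mem k := by
    rintro _ ⟨f, rfl⟩
    rw [opNeg_opMul]
    exact ⟨_, rfl⟩

/-- The right action of the Connes-Moscovici algebra on the jet algebra. -/
noncomputable def act (h : CMHopf n) : Module.End ℂ (Jets n) := ((actData n).lift h).unop

theorem act_mul (h k : CMHopf n) (f : Jets n) : act (h * k) f = act k (act h f) := by
  simp [act]

theorem act_X (k : Fin n) (f : Jets n) : act (X k) f = - dX k f := by
  rw [act, LiftData.lift_X]; rfl

theorem act_Y (i j : Fin n) (f : Jets n) : act (Y i j) f = - dY i j f := by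
  rw [act, LiftData.lift_Y]; rfl

theorem act_al2 (i j k : Fin n) (f : Jets n) : act (al2 i j k) f = f * a i {j, k} := by
  rw [act, al2, LiftData.lift_al2]; exact opMul_apply _ _

/-- The projection of the Connes-Moscovici algebra to the jet algebra, with kernel the right
ideal generated by `g`. -/
noncomputable def proj (n : ℕ) : CMHopf n →ₗ[ℂ] Jets n where
  toFun h := act h 1
  map_add' h k := by simp [act]
  map_smul' r h := by simp [act]

theorem proj_mul (h k : CMHopf n) : proj n (h * k) = act k (proj n h) := act_mul h k 1

theorem proj_mul_X (h : CMHopf n) (k : Fin n) : proj n (h * X k) = - dX k (proj n h) := by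
  rw [proj_mul, act_X]

theorem proj_mul_al2 (h : CMHopf n) (i j k : Fin n) :
    proj n (h * al2 i j k) = proj n h * a i {j, k} := by
  rw [proj_mul, act_al2]

/-- In a right action the left factor acts first, here on `1`, which derivations kill. -/
theorem proj_X_mul (h : CMHopf n) (k : Fin n) : proj n (X k * h) = 0 := by
  change act (X k * h) 1 = 0
  rw [act_mul, act_X]; simp

theorem proj_Y_mul (h : CMHopf n) (i j : Fin n) : proj n (Y i j * h) = 0 := by
  change act (Y i j * h) 1 = 0
  rw [act_mul, act_Y]; simp

theorem constantCoeff_a (i : Fin n) (J : Multiset (Fin n)) (hJ : 2 ≤ J.card) :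
    MvPolynomial.constantCoeff (a i J) = 0 := by
  rw [a_var (i, ⟨J, hJ⟩), MvPolynomial.constantCoeff_X]

theorem constantCoeff_mkDerivation (g : JetVar n → Jets n)
    (hg : ∀ w, MvPolynomial.constantCoeff (g w) = 0) (f : Jets n) :
    MvPolynomial.constantCoeff (MvPolynomial.mkDerivation ℂ g f) = 0 := by
  induction f using MvPolynomial.induction_on with
  | C r => simp
  | add p q hp hq => rw [map_add, map_add, hp, hq, add_zero]
  | mul_X p w hp => simp [hp, hg]

/-- The constant coefficient is evaluation at the identity diffeomorphism, a fixed point of the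
affine group; hence it intertwines the action with the counit. -/
theorem constantCoeff_act (h : CMHopf n) (f : Jets n) :
    MvPolynomial.constantCoeff (act h f) = MvPolynomial.constantCoeff f * counit n h := by
  let T : Subalgebra ℂ (CMHopf n) :=
    { carrier := {h | ∀ f : Jets n, MvPolynomial.constantCoeff (act h f) =
        MvPolynomial.constantCoeff f * counit n h}
      mul_mem' := fun {h k} hh hk f => by rw [act_mul, hk, hh, map_mul, mul_assoc]
      add_mem' := fun {h k} hh hk f => by
        have : act (h + k) f = act h f + act k f := by simp [act]
        rw [this, map_add, hh, hk, map_add, mul_add]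
      algebraMap_mem' := fun r f => by
        have : act (algebraMap ℂ (CMHopf n) r) f = r • f := by simp [act]
        rw [this, AlgHom.commutes, MvPolynomial.smul_eq_C_mul, map_mul]
        simp [mul_comm] }
  refine generated T (fun k f => ?_) (fun i j f => ?_) (fun i j k f => ?_) h f
  · rw [act_X, counit_X, mul_zero, map_neg, dX, constantCoeff_mkDerivation, neg_zero]
    intro w
    have := w.2.2
    rw [map_sub, map_sum, constantCoeff_a _ _ (by simp; omega)]
    simp only [map_mul, constantCoeff_a _ _ this, mul_zero, Finset.sum_const_zero, sub_zero]
  · rw [act_Y, counit_Y, mul_zero, map_neg, dY, constantCoeff_mkDerivation, neg_zero]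
    intro w
    have hw := w.2.2
    rw [map_sub, map_nsmul, apply_ite MvPolynomial.constantCoeff, constantCoeff_a _ _ hw, map_zero,
      ite_self, sub_zero]
    by_cases hj : j ∈ w.2.1
    · rw [constantCoeff_a, smul_zero]
      rw [Multiset.card_cons, Multiset.card_erase_add_one hj]
      exact hw
    · rw [Multiset.count_eq_zero_of_notMem hj, zero_smul]
  · rw [act_al2, counit_al2, map_mul, constantCoeff_a _ _ (by simp)]

theorem constantCoeff_proj (h : CMHopf n) :
    MvPolynomial.constantCoeff (proj n h) = counit n h := by
  change MvPolynomial.constantCoeff (act h 1) = _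
  rw [constantCoeff_act, map_one, one_mul]

/-! ### Partial derivatives of jets and their commutators with `dX` -/

/-- The partial derivative with respect to `α^i_J`. -/
noncomputable def jetDeriv (i : Fin n) (J : Multiset (Fin n)) :
    Derivation ℂ (Jets n) (Jets n) :=
  if h : 2 ≤ J.card then MvPolynomial.pderiv (i, ⟨J, h⟩) else 0

theorem jetDeriv_a (i s : Fin n) (J K : Multiset (Fin n)) (hJ : 2 ≤ J.card) :
    jetDeriv i J (a s K) = if i = s ∧ J = K then 1 else 0 := by
  rw [jetDeriv, dif_pos hJ]
  by_cases hK : 2 ≤ K.card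
  · rw [a_var (s, ⟨K, hK⟩), MvPolynomial.pderiv_X, Pi.single_apply]
    simp [Prod.ext_iff, eq_comm]
  · have h : ¬(i = s ∧ J = K) := fun h => hK (h.2 ▸ hJ)
    rw [a, dif_neg hK, if_neg h]
    split_ifs <;> simp

/-- Both sides come from an equality of derivations, checked on variables. The term `jetDeriv i J f`
records that `dX k` sends `α^i_J` to `α^i_{kJ}` up to products; it drives the descent on the order
in `jetDeriv_jetCoef`. -/
theorem jetDeriv_dX (i k : Fin n) (J : Multiset (Fin n)) (hJ : 2 ≤ J.card) (f : Jets n) :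
    jetDeriv i (k ::ₘ J) (dX k f) = dX k (jetDeriv i (k ::ₘ J) f) + jetDeriv i J f
      - ∑ s, a s {i, k} * jetDeriv s (k ::ₘ J) f := by
  have hkJ : 2 ≤ (k ::ₘ J).card := by simp; omega
  have h : ⁅jetDeriv i (k ::ₘ J), dX k⁆ = jetDeriv i J - ∑ s, a s {i, k} • jetDeriv s (k ::ₘ J) := by
    refine hom_ext fun t K hK => ?_
    have hK0 : K ≠ 0 := by rintro rfl; simp at hK
    rw [Derivation.commutator_apply, dX_a _ _ _ hK0, jetDeriv_a _ _ _ _ hkJ, derivation_ite]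
    simp only [map_sub, map_sum, Derivation.leibniz, smul_eq_mul, jetDeriv_a _ _ _ _ hkJ,
      jetDeriv_a _ _ _ _ hJ, Derivation.sub_apply, sum_derivation_apply, Derivation.smul_apply]
    -- `k ::ₘ J` has at least three entries, so the factors `a t {s, k}` are not differentiated.
    have h2 : ∀ s : Fin n, ¬ (i = t ∧ k ::ₘ J = {s, k}) := by
      rintro s ⟨-, h⟩
      have := congrArg Multiset.card h
      simp at this
      omega
    simp only [h2, if_false, mul_zero, add_zero, Multiset.cons_inj_right]
    have h3 : ∀ s : Fin n, (a t {s, k} * if i = s ∧ k ::ₘ J = K then (1 : Jets n) else 0) =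
        if i = s then (if k ::ₘ J = K then a t {i, k} else 0) else 0 := by
      intro s; split_ifs <;> simp_all
    have h4 : ∀ s : Fin n, (a s {i, k} * if s = t ∧ k ::ₘ J = K then (1 : Jets n) else 0) =
        if s = t then (if k ::ₘ J = K then a t {i, k} else 0) else 0 := by
      intro s; split_ifs <;> simp_all
    simp only [h3, h4, Finset.sum_ite_eq, Finset.sum_ite_eq', Finset.mem_univ, if_true,
      Derivation.map_one_eq_zero, ite_self, sub_zero]
  have h1 := congrArg (fun D => D f) h
  simp only [Derivation.commutator_apply, Derivation.sub_apply, sum_derivation_apply,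
    Derivation.smul_apply, smul_eq_mul] at h1
  rw [sub_eq_iff_eq_add] at h1
  rw [h1]
  ring

theorem eq_C_of_jetDeriv (f : Jets n) (h : ∀ i J, jetDeriv i J f = 0) :
    f = MvPolynomial.C (MvPolynomial.constantCoeff f) := by
  ext m
  by_cases hm : m = 0
  · subst hm; simp [MvPolynomial.constantCoeff_eq]
  · rw [MvPolynomial.coeff_C, if_neg (Ne.symm hm)]
    obtain ⟨w, hw⟩ := Finsupp.ne_iff.1 hm
    have h1 := h w.1 w.2.1
    rw [jetDeriv, dif_pos w.2.2] at h1
    -- This coefficient of the partial derivative is the coefficient of `m` in `f` times the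
    -- exponent of `w` in `m`, which is nonzero in characteristic zero.
    have h2 := congrArg (MvPolynomial.coeff (m - Finsupp.single w 1)) h1
    rw [MvPolynomial.coeff_pderiv, tsub_add_cancel_of_le] at h2
    · refine (mul_eq_zero.1 h2).resolve_right ?_
      exact Nat.cast_add_one_ne_zero _
    · exact Finsupp.single_le_iff.2 (Nat.one_le_iff_ne_zero.2 hw)

theorem exists_jetDeriv_eq_zero (f : Jets n) :
    ∃ r, ∀ i J, r < J.card → jetDeriv i J f = 0 := by
  refine ⟨f.vars.sup fun w => w.2.1.card, fun i J hJ => ?_⟩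
  rw [jetDeriv]
  split_ifs with h
  · refine MvPolynomial.pderiv_eq_zero_of_notMem_vars fun hm => ?_
    exact absurd (Finset.le_sup (f := fun w : JetVar n => w.2.1.card) hm) (not_le.2 hJ)
  · rfl

end Jets

end CM

/-! ### Matrix coefficients of anti-Yetter–Drinfeld modules over a general Hopf algebra -/

namespace ActCoact

section general

variable {H V : Type*} [Ring H] [HopfAlgebra ℂ H] [AddCommGroup V] [Module ℂ V]

/-- The linear map `a ⊗ b ⊗ c ↦ S(c) κ(b) a`. -/
noncomputable def sandwich (κ : H →ₗ[ℂ] H) : H ⊗[ℂ] (H ⊗[ℂ] H) →ₗ[ℂ] H :=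
  LinearMap.mul' ℂ H ∘ₗ TensorProduct.map (LinearMap.mul' ℂ H ∘ₗ
    TensorProduct.map (HopfAlgebra.antipode ℂ) κ ∘ₗ (TensorProduct.comm ℂ H H).toLinearMap)
      LinearMap.id ∘ₗ (TensorProduct.comm ℂ H (H ⊗[ℂ] H)).toLinearMap

@[simp] theorem sandwich_tmul (κ : H →ₗ[ℂ] H) (a b c : H) :
    sandwich κ (a ⊗ₜ (b ⊗ₜ c)) = HopfAlgebra.antipode ℂ c * κ b * a := rfl

/-- The iterated comultiplication `h ↦ h₍₁₎ ⊗ (h₍₂₎ ⊗ h₍₃₎)`. -/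
noncomputable def comul₂ (H : Type*) [Ring H] [HopfAlgebra ℂ H] :
    H →ₗ[ℂ] H ⊗[ℂ] (H ⊗[ℂ] H) :=
  (Coalgebra.comul (R := ℂ) (A := H)).lTensor H ∘ₗ Coalgebra.comul (R := ℂ)

/-- Supplies an expression of the kind over which the field `ayd` of `IsAYD` quantifies. -/
theorem exists_sum_tmul_tmul (t : H ⊗[ℂ] (H ⊗[ℂ] H)) : ∃ (m : ℕ) (a b c : Fin m → H),
    t = ∑ r, a r ⊗ₜ[ℂ] (b r ⊗ₜ[ℂ] c r) := by
  obtain ⟨k, a, u, rfl⟩ := TensorProduct.exists_sum_tmul_eq t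
  choose l b c hu using fun j => TensorProduct.exists_sum_tmul_eq (u j)
  let e := Fintype.equivFin (Σ j : Fin k, Fin (l j))
  refine ⟨_, fun r => a (e.symm r).1, fun r => b _ (e.symm r).2, fun r => c _ (e.symm r).2, ?_⟩
  rw [Equiv.sum_comp e.symm fun s => a s.1 ⊗ₜ[ℂ] (b s.1 s.2 ⊗ₜ[ℂ] c s.1 s.2), Fintype.sum_sigma]
  refine Finset.sum_congr rfl fun j _ => ?_
  conv_lhs => rw [hu j, TensorProduct.tmul_sum]

variable (M : ActCoact H V)

/-- The matrix coefficient `v₍₋₁₎ f(v₍₀₎)`. -/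
noncomputable def coef (f : Module.Dual ℂ V) : V →ₗ[ℂ] H :=
  (TensorProduct.rid ℂ H).toLinearMap ∘ₗ f.lTensor H ∘ₗ M.coact

theorem coef_apply (f : Module.Dual ℂ V) (v : V) :
    M.coef f v = TensorProduct.rid ℂ H (f.lTensor H (M.coact v)) := rfl

theorem coef_add (f g : Module.Dual ℂ V) (v : V) : M.coef (f + g) v = M.coef f v + M.coef g v := by
  simp [coef_apply, LinearMap.lTensor_add]

theorem coef_sub (f g : Module.Dual ℂ V) (v : V) : M.coef (f - g) v = M.coef f v - M.coef g v := by
  simp [coef_apply, LinearMap.lTensor_sub]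

theorem coef_smul (r : ℂ) (f : Module.Dual ℂ V) (v : V) : M.coef (r • f) v = r • M.coef f v := by
  simp [coef_apply, LinearMap.lTensor_smul]

theorem coef_zero (v : V) : M.coef 0 v = 0 := by
  simp [coef_apply]

/-- The functional `v ↦ f(v · b)`. -/
noncomputable def precomp (f : Module.Dual ℂ V) (b : H) : Module.Dual ℂ V := f ∘ₗ M.act.flip b

theorem precomp_apply (f : Module.Dual ℂ V) (b : H) (v : V) :
    M.precomp f b v = f (M.act v b) := rfl

/-- The linear map `b ↦ v₍₋₁₎ f(v₍₀₎ · b)`. -/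
noncomputable def coefAct (f : Module.Dual ℂ V) (v : V) : H →ₗ[ℂ] H where
  toFun b := M.coef (M.precomp f b) v
  map_add' b c := by
    rw [← coef_add, show M.precomp f (b + c) = M.precomp f b + M.precomp f c from
      LinearMap.ext fun w => by simp [precomp_apply]]
  map_smul' r b := by
    rw [RingHom.id_apply, ← coef_smul, show M.precomp f (r • b) = r • M.precomp f b from
      LinearMap.ext fun w => by simp [precomp_apply]]

theorem coefAct_apply (f : Module.Dual ℂ V) (v : V) (b : H) :
    M.coefAct f v b = M.coef (M.precomp f b) v := rfl

theorem rid_lTensor_twist (f : Module.Dual ℂ V) (a b c : H) (t : H ⊗[ℂ] V) :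
    TensorProduct.rid ℂ H (f.lTensor H (M.twist a b c t)) = HopfAlgebra.antipode ℂ c *
      TensorProduct.rid ℂ H ((M.precomp f b).lTensor H t) * a := by
  induction t using TensorProduct.induction_on with
  | zero => simp
  | add s t hs ht => simp only [map_add, hs, ht, mul_add, add_mul]
  | tmul x v => simp [twist, precomp_apply, mul_assoc]

variable {M}

/-- Applying `id ⊗ f` to the compatibility condition leaves an identity in `H` itself; all later
uses of the condition go through this form. -/
theorem IsAYD.coef_act (hM : M.IsAYD) (f : Module.Dual ℂ V) (v : V) (h : H) :
    M.coef f (M.act v h) = sandwich (M.coefAct f v) (comul₂ H h) := by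
  obtain ⟨m, a, b, c, ht⟩ := exists_sum_tmul_tmul (comul₂ H h)
  rw [ht, coef_apply, hM.ayd v h m a b c ht, map_sum, map_sum, map_sum]
  exact Finset.sum_congr rfl fun r _ => M.rid_lTensor_twist f _ _ _ _

theorem IsAYD.coefAct_one (hM : M.IsAYD) (f : Module.Dual ℂ V) (v : V) :
    M.coefAct f v 1 = M.coef f v := by
  rw [coefAct_apply, show M.precomp f 1 = f from
    LinearMap.ext fun w => by rw [precomp_apply, hM.act_one]]

theorem IsAYD.counit_coef (hM : M.IsAYD) (f : Module.Dual ℂ V) (v : V) :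
    Coalgebra.counit (R := ℂ) (M.coef f v) = f v := by
  have h : ∀ t : H ⊗[ℂ] V, Coalgebra.counit (R := ℂ) (TensorProduct.rid ℂ H (f.lTensor H t)) =
      f (TensorProduct.lid ℂ V ((Coalgebra.counit (R := ℂ) (A := H)).rTensor V t)) := by
    intro t
    induction t using TensorProduct.induction_on with
    | zero => simp
    | add s t hs ht => simp only [map_add, hs, ht]
    | tmul x v => simp [mul_comm]
  rw [coef_apply, h, hM.counit_coact]

/-- This is coassociativity: contracting the second leg of `Δ` of a matrix coefficient gives a
matrix coefficient for another functional. In particular, if `l` vanishes on all coefficients, the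
contraction is zero. -/
theorem IsAYD.lTensor_comul_coef (hM : M.IsAYD) (l : H →ₗ[ℂ] ℂ) (f : Module.Dual ℂ V)
    (v : V) : TensorProduct.rid ℂ H (l.lTensor H (Coalgebra.comul (R := ℂ) (M.coef f v))) =
      M.coef (l ∘ₗ M.coef f) v := by
  have h1 : ∀ t : H ⊗[ℂ] V, l.lTensor H (Coalgebra.comul (R := ℂ)
      (TensorProduct.rid ℂ H (f.lTensor H t))) = (l ∘ₗ (TensorProduct.rid ℂ H).toLinearMap ∘ₗ
        f.lTensor H).lTensor H (TensorProduct.assoc ℂ H H V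
          ((Coalgebra.comul (R := ℂ) (A := H)).rTensor V t)) := by
    intro t
    induction t using TensorProduct.induction_on with
    | zero => simp
    | add s t hs ht => simp only [map_add, hs, ht]
    | tmul x v =>
      simp only [LinearMap.lTensor_tmul, TensorProduct.rid_tmul, map_smul, LinearMap.rTensor_tmul]
      generalize Coalgebra.comul (R := ℂ) x = u
      induction u using TensorProduct.induction_on with
      | zero => simp
      | add s t hs ht => simp only [map_add, smul_add, TensorProduct.add_tmul, hs, ht]
      | tmul y z =>
        simp only [TensorProduct.assoc_tmul, LinearMap.lTensor_tmul, LinearMap.comp_apply,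
          LinearEquiv.coe_coe, TensorProduct.rid_tmul, map_smul, TensorProduct.tmul_smul]
  rw [coef_apply, h1, hM.coassoc, ← LinearMap.comp_apply, ← LinearMap.lTensor_comp]
  rfl

/-- An element of `H ⊗ V` is determined by its coordinates along a finite basis of `V`. -/
theorem tmul_eq_of_coef [FiniteDimensional ℂ V] (v : V)
    (h : ∀ f : Module.Dual ℂ V, M.coef f v = algebraMap ℂ H (f v)) : M.coact v = 1 ⊗ₜ v := by
  let b := Module.finBasis ℂ V
  have h1 : ∀ t : H ⊗[ℂ] V,
      t = ∑ i, TensorProduct.rid ℂ H ((b.coord i).lTensor H t) ⊗ₜ[ℂ] b i := by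
    intro t
    induction t using TensorProduct.induction_on with
    | zero => simp
    | add s t hs ht =>
      simp only [map_add, TensorProduct.add_tmul, Finset.sum_add_distrib]
      rw [← hs, ← ht]
    | tmul x v =>
      simp only [LinearMap.lTensor_tmul, TensorProduct.rid_tmul, TensorProduct.smul_tmul,
        ← TensorProduct.tmul_sum, Module.Basis.coord_apply, b.sum_repr]
  rw [h1 (M.coact v)]
  have h2 : ∀ i, TensorProduct.rid ℂ H ((b.coord i).lTensor H (M.coact v)) =
      (b.coord i v) • (1 : H) := fun i => by
    rw [← Algebra.algebraMap_eq_smul_one]; exact h (b.coord i)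
  simp only [h2, TensorProduct.smul_tmul, ← TensorProduct.tmul_sum, Module.Basis.coord_apply,
    b.sum_repr]

theorem nonempty_iso_copies [FiniteDimensional ℂ V] (χ : H →ₐ[ℂ] ℂ)
    (hact : ∀ v h, M.act v h = χ h • v) (hcoact : ∀ v, M.coact v = 1 ⊗ₜ v) :
    Nonempty (Iso M ((ofChar χ).copies (Module.finrank ℂ V))) := by
  refine ⟨⟨(Module.finBasis ℂ V).equivFun, fun v h => ?_, fun v => ?_⟩⟩
  · rw [hact, map_smul]
    ext i
    simp [copies, ofChar, mul_comm]
  · rw [hcoact, LinearMap.lTensor_tmul]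
    generalize (Module.finBasis ℂ V).equivFun v = w
    simp only [copies, ofChar, LinearMap.sum_apply, LinearMap.comp_apply, LinearMap.proj_apply,
      TensorProduct.mk_apply, LinearMap.lTensor_tmul, ← TensorProduct.tmul_sum, LinearMap.coe_single]
    rw [Finset.univ_sum_single w]

/-- With trivial coaction on a line, compatibility is the single identity `S(h₍₃₎) χ(h₍₂₎) h₍₁₎ =
χ(h)`; the other axioms are formal. -/
theorem ofChar_isAYD (χ : H →ₐ[ℂ] ℂ)
    (hχ : ∀ h, sandwich ((Algebra.linearMap ℂ H) ∘ₗ χ.toLinearMap) (comul₂ H h) =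
      algebraMap ℂ H (χ h)) : (ofChar χ).IsAYD where
  act_one v := by simp [ofChar]
  act_mul v h k := by simp [ofChar, mul_assoc]
  counit_coact v := by simp [ofChar]
  coassoc v := by simp [ofChar, Algebra.TensorProduct.one_def]
  ayd v h m a b c ht := by
    have h1 := hχ h
    rw [comul₂, LinearMap.comp_apply, ht, map_sum] at h1
    have h2 : ∀ r, (ofChar χ).twist (a r) (b r) (c r) ((ofChar χ).coact v) =
        sandwich ((Algebra.linearMap ℂ H) ∘ₗ χ.toLinearMap) (a r ⊗ₜ (b r ⊗ₜ c r)) ⊗ₜ v := by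
      intro r
      rw [sandwich_tmul]
      simp [ofChar, twist, Algebra.algebraMap_eq_smul_one, TensorProduct.smul_tmul, mul_comm v]
    rw [Finset.sum_congr rfl fun r _ => h2 r, ← TensorProduct.sum_tmul, h1]
    simp [ofChar, Algebra.algebraMap_eq_smul_one, TensorProduct.smul_tmul, mul_comm v]

/-- Because `S` reverses products, the value on `s` ends up in the middle of the product; being a
scalar, it can be pulled out. Hence the identity for a character need only be checked on generators.
-/
theorem sandwich_mul (χ : H →ₐ[ℂ] ℂ) (r : ℂ) (s t : H ⊗[ℂ] (H ⊗[ℂ] H))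
    (hs : sandwich ((Algebra.linearMap ℂ H) ∘ₗ χ.toLinearMap) s = algebraMap ℂ H r) :
    sandwich ((Algebra.linearMap ℂ H) ∘ₗ χ.toLinearMap) (s * t) =
      algebraMap ℂ H r * sandwich ((Algebra.linearMap ℂ H) ∘ₗ χ.toLinearMap) t := by
  have h : ∀ a b c : H, sandwich ((Algebra.linearMap ℂ H) ∘ₗ χ.toLinearMap)
      (s * a ⊗ₜ (b ⊗ₜ c)) = χ b • (HopfAlgebra.antipode ℂ c *
        sandwich ((Algebra.linearMap ℂ H) ∘ₗ χ.toLinearMap) s * a) := by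
    intro a b c
    clear hs
    induction s using TensorProduct.induction_on with
    | zero => simp
    | add x y hx hy => simp only [add_mul, map_add, hx, hy, mul_add, smul_add]
    | tmul x u =>
      induction u using TensorProduct.induction_on with
      | zero => simp
      | add y z hy hz =>
        simp only [TensorProduct.tmul_add, add_mul, map_add, hy, hz, mul_add, smul_add]
      | tmul y z =>
        simp [HopfAlgebra.antipode_mul_antidistrib, Algebra.algebraMap_eq_smul_one, smul_smul, mul_assoc, mul_comm (χ y)]
  induction t using TensorProduct.induction_on with
  | zero => simp
  | add x y hx hy => simp only [mul_add, map_add, hx, hy]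
  | tmul x u =>
    induction u using TensorProduct.induction_on with
    | zero => simp
    | add y z hy hz => simp only [TensorProduct.tmul_add, mul_add, map_add, hy, hz]
    | tmul y z =>
      rw [h, hs]
      simp [Algebra.algebraMap_eq_smul_one, smul_smul]

end general

end ActCoact

/-! ### The modular character and the module `C_δ` -/

namespace CM

variable {n : ℕ}

open ActCoact

theorem comul_eq (h : CMHopf n) : Coalgebra.comul (R := ℂ) h = comul n h := rfl

theorem counit_eq (h : CMHopf n) : Coalgebra.counit (R := ℂ) h = counit n h := rfl

theorem antipode_eq (h : CMHopf n) : HopfAlgebra.antipode ℂ h = antipode n h := rfl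

theorem antipode_one : antipode n 1 = 1 := by
  simpa using antipode_algebraMap (n := n) 1

/-- The iterated comultiplication of `X_k` has `X_k` in each of the three legs and, summed over `i,
j`, the terms `α ⊗ Y ⊗ 1`, `α ⊗ 1 ⊗ Y` and `1 ⊗ α ⊗ Y`. -/
theorem sandwich_X (κ : CMHopf n →ₗ[ℂ] CMHopf n) (k : Fin n) :
    sandwich κ (comul₂ _ (X k)) = κ 1 * X k + κ (X k) + antipode n (X k) * κ 1 +
      ∑ i, ∑ j, (κ (Y i j) * al2 i j k - Y i j * κ 1 * al2 i j k - Y i j * κ (al2 i j k)) := by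
  simp only [comul₂, LinearMap.comp_apply, comul_eq, comul_X, map_add, map_sum,
    LinearMap.lTensor_tmul, comul_Y, map_one, TensorProduct.tmul_add, TensorProduct.tmul_sum,
    Algebra.TensorProduct.one_def, sandwich_tmul, antipode_eq, antipode_one, antipode_Y,
    one_mul, mul_one, neg_mul, Finset.sum_add_distrib, Finset.sum_sub_distrib,
    Finset.sum_neg_distrib]
  abel

theorem sandwich_Y (κ : CMHopf n →ₗ[ℂ] CMHopf n) (i j : Fin n) :
    sandwich κ (comul₂ _ (Y i j)) = κ 1 * Y i j + κ (Y i j) - Y i j * κ 1 := by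
  simp only [comul₂, LinearMap.comp_apply, comul_eq, comul_Y, map_add,
    LinearMap.lTensor_tmul, map_one, TensorProduct.tmul_add,
    Algebra.TensorProduct.one_def, sandwich_tmul, antipode_eq, antipode_one, antipode_Y,
    one_mul, mul_one, neg_mul]
  abel

theorem sandwich_al2 (κ : CMHopf n →ₗ[ℂ] CMHopf n) (i j k : Fin n) :
    sandwich κ (comul₂ _ (al2 i j k)) =
      κ 1 * al2 i j k + κ (al2 i j k) - al2 i j k * κ 1 := by
  simp only [comul₂, LinearMap.comp_apply, comul_eq, comul_al2, map_add,
    LinearMap.lTensor_tmul, map_one, TensorProduct.tmul_add,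
    Algebra.TensorProduct.one_def, sandwich_tmul, antipode_eq, antipode_one, antipode_al2,
    one_mul, mul_one, neg_mul]
  abel

/-- The trace `∑ α^i_{ik}`. -/
noncomputable def trAl (k : Fin n) : CMHopf n := ∑ i, al2 i i k

/-- Of the three terms of `Y_al2`, the first and the last sum to `n` times the trace with opposite
signs; the middle one contributes the trace once. This is the source of the modular character. -/
theorem sum_Y_al2 (k : Fin n) : ∑ i, ∑ j, ⁅(Y i j : CMHopf n), al2 i j k⁆ = trAl k := by
  simp only [Y_al2, Finset.sum_add_distrib, Finset.sum_sub_distrib, Finset.sum_ite_eq',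
    Finset.mem_univ, if_true, Finset.sum_const]
  simp only [trAl, al2_symm _ k]
  rw [← Finset.smul_sum]
  abel

theorem sandwich_modularChar (h : CMHopf n) :
    sandwich ((Algebra.linearMap ℂ (CMHopf n)) ∘ₗ (modularChar n).toLinearMap) (comul₂ _ h) =
      algebraMap ℂ _ (modularChar n h) := by
  have hmul : ∀ h k : CMHopf n, comul₂ _ (h * k) = comul₂ _ h * comul₂ _ k := by
    intro h k
    simp only [comul₂, LinearMap.comp_apply, comul_eq, map_mul]
    exact map_mul (Algebra.TensorProduct.map (AlgHom.id ℂ (CMHopf n)) (comul n)) _ _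
  let T : Subalgebra ℂ (CMHopf n) :=
    { carrier := {h | sandwich ((Algebra.linearMap ℂ (CMHopf n)) ∘ₗ (modularChar n).toLinearMap)
        (comul₂ _ h) = algebraMap ℂ _ (modularChar n h)}
      mul_mem' := fun {h k} hh hk => by
        change _ = _
        rw [hmul, sandwich_mul _ _ _ _ hh, hk, map_mul, map_mul]
      add_mem' := fun {h k} hh hk => by
        change _ = _
        rw [map_add, map_add, hh, hk, map_add, map_add]
      algebraMap_mem' := fun r => by
        change _ = _
        rw [Algebra.algebraMap_eq_smul_one, map_smul, map_smul, map_smul, map_one (modularChar n)]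
        simp [comul₂, Algebra.TensorProduct.one_def,
          Algebra.algebraMap_eq_smul_one] }
  refine generated T (fun k => ?_) (fun i j => ?_) (fun i j k => ?_) h
  · change _ = _
    rw [sandwich_X]
    simp only [LinearMap.comp_apply, AlgHom.toLinearMap_apply, map_one, Algebra.linearMap_apply,
      modularChar_X, modularChar_Y, modularChar_al2, map_zero, antipode_X, one_mul, mul_one,
      mul_zero, sub_zero, add_zero, apply_ite (algebraMap ℂ (CMHopf n)), ite_mul, zero_mul,
      Finset.sum_sub_distrib, Finset.sum_ite_eq, Finset.mem_univ, if_true]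
    -- Moving `Y` to the right of `α` costs the trace, which cancels the trace coming from
    -- `δ(Y_i^j)`.
    have h1 := sum_Y_al2 (n := n) k
    simp only [Ring.lie_def, Finset.sum_sub_distrib] at h1
    rw [sub_eq_iff_eq_add] at h1
    rw [h1, trAl]
    abel
  · change _ = _
    rw [sandwich_Y]
    simp only [LinearMap.comp_apply, AlgHom.toLinearMap_apply, map_one, Algebra.linearMap_apply]
    simp
  · change _ = _
    rw [sandwich_al2]
    simp only [LinearMap.comp_apply, AlgHom.toLinearMap_apply, map_one, Algebra.linearMap_apply]
    simp

theorem Cdelta_isAYD (n : ℕ) : (Cdelta n).IsAYD := ofChar_isAYD _ sandwich_modularChar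

/-! ### The action on a finite-dimensional module: bounded order of jets -/

section module

variable {V : Type*} [AddCommGroup V] [Module ℂ V] {M : ActCoact (CMHopf n) V}

theorem coef_act_X (hM : M.IsAYD) (f : Module.Dual ℂ V) (v : V) (k : Fin n) :
    M.coef f (M.act v (X k)) = M.coef f v * X k + M.coef (M.precomp f (X k)) v +
      antipode n (X k) * M.coef f v + ∑ i, ∑ j, (M.coef (M.precomp f (Y i j)) v * al2 i j k -
        Y i j * M.coef f v * al2 i j k - Y i j * M.coef (M.precomp f (al2 i j k)) v) := by
  rw [hM.coef_act, sandwich_X, hM.coefAct_one]; rfl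

theorem coef_act_Y (hM : M.IsAYD) (f : Module.Dual ℂ V) (v : V) (i j : Fin n) :
    M.coef f (M.act v (Y i j)) = M.coef f v * Y i j + M.coef (M.precomp f (Y i j)) v -
      Y i j * M.coef f v := by
  rw [hM.coef_act, sandwich_Y, hM.coefAct_one]; rfl

theorem coef_act_al2 (hM : M.IsAYD) (f : Module.Dual ℂ V) (v : V) (i j k : Fin n) :
    M.coef f (M.act v (al2 i j k)) = M.coef f v * al2 i j k +
      M.coef (M.precomp f (al2 i j k)) v - al2 i j k * M.coef f v := by
  rw [hM.coef_act, sandwich_al2, hM.coefAct_one]; rfl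

/-- The matrix coefficients, projected to the jet algebra. -/
noncomputable def jetCoef (M : ActCoact (CMHopf n) V) (f : Module.Dual ℂ V) (v : V) : Jets n :=
  Jets.proj n (M.coef f v)

/-- In `S(X_k) = -X_k + ∑ Y_i^j α^i_{jk} - ∑ α^i_{ik}`, the terms beginning with an element of
`gl(n)^aff` are killed by the projection. -/
theorem proj_antipode_X_mul (k : Fin n) (h : CMHopf n) :
    Jets.proj n (antipode n (X k) * h) = - Jets.proj n (trAl k * h) := by
  have h1 : ∑ i, ∑ j, (al2 i j k : CMHopf n) * Y i j = ∑ i, ∑ j, Y i j * al2 i j k - trAl k := by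
    rw [← sum_Y_al2]
    simp only [Ring.lie_def, Finset.sum_sub_distrib]
    abel
  rw [antipode_X, h1, add_mul, neg_mul, sub_mul, map_add, map_neg, map_sub, Jets.proj_X_mul]
  simp only [Finset.sum_mul, mul_assoc, map_sum, Jets.proj_Y_mul, Finset.sum_const_zero]
  simp

/-- Left multiplication by `α` is not controlled by the projection, and `X_k` alone leaves the term
`trAl k * M.coef f v`. The identity for `trAl k` leaves the same term, so subtracting removes it, at
the cost of the shift `Y_i^j - δ_{ij}`. -/
theorem jetCoef_act_X (hM : M.IsAYD) (f : Module.Dual ℂ V) (v : V) (k : Fin n) :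
    jetCoef M f (M.act v (X k - trAl k)) = - Jets.dX k (jetCoef M f v) +
      jetCoef M (M.precomp f (X k - trAl k)) v + ∑ i, ∑ j,
        jetCoef M (M.precomp f (Y i j) - if i = j then f else 0) v * Jets.a i {j, k} := by
  have h1 := congrArg (Jets.proj n) (coef_act_X hM f v k)
  have h2 : jetCoef M f (M.act v (trAl k)) = ∑ i, jetCoef M f v * Jets.a i {i, k} +
      jetCoef M (M.precomp f (trAl k)) v - Jets.proj n (trAl k * M.coef f v) := by
    have e1 : M.coef f (M.act v (trAl k)) = ∑ i, M.coef f (M.act v (al2 i i k)) := by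
      simp [trAl]
    have e2 : M.coef (M.precomp f (trAl k)) v = ∑ i, M.coef (M.precomp f (al2 i i k)) v := by
      simp only [← M.coefAct_apply, trAl, map_sum]
    have e3 : Jets.proj n (trAl k * M.coef f v) = ∑ i, Jets.proj n (al2 i i k * M.coef f v) := by
      simp only [trAl, Finset.sum_mul, map_sum]
    simp only [jetCoef, e1, e2, e3, coef_act_al2 hM, map_sum, map_sub, map_add, Jets.proj_mul_al2,
      Finset.sum_sub_distrib, Finset.sum_add_distrib]
  have e3 : jetCoef M f (M.act v (X k - trAl k)) = jetCoef M f (M.act v (X k)) -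
      jetCoef M f (M.act v (trAl k)) := by simp [jetCoef]
  have e4 : jetCoef M (M.precomp f (X k - trAl k)) v = jetCoef M (M.precomp f (X k)) v -
      jetCoef M (M.precomp f (trAl k)) v := by
    simp only [jetCoef, ← M.coefAct_apply, map_sub]
  have e5 : ∀ i j, jetCoef M (M.precomp f (Y i j) - if i = j then f else 0) v =
      jetCoef M (M.precomp f (Y i j)) v - if i = j then jetCoef M f v else 0 := by
    intro i j
    rw [jetCoef, coef_sub, map_sub]
    split_ifs <;> simp [jetCoef, coef_zero]
  simp only [map_add, map_sum, map_sub, Jets.proj_mul_X, Jets.proj_mul_al2, mul_assoc,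
    Jets.proj_Y_mul, proj_antipode_X_mul, sub_zero] at h1
  rw [e3, e4, h2]
  simp only [e5, sub_mul, ite_mul, zero_mul, Finset.sum_sub_distrib, Finset.sum_ite_eq,
    Finset.mem_univ, if_true]
  simp only [jetCoef] at h1 ⊢
  rw [h1]
  ring

/-- By bilinearity in `f` and `v`, finitely many jets span all of them, and each involves finitely
many variables. -/
theorem exists_jetDeriv_jetCoef [FiniteDimensional ℂ V] : ∃ r, ∀ f v i J, r < J.card →
    Jets.jetDeriv i J (jetCoef M f v) = 0 := by
  let b := Module.finBasis ℂ V
  let c := Module.finBasis ℂ (Module.Dual ℂ V)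
  choose r hr using fun x : Fin _ × Fin _ => Jets.exists_jetDeriv_eq_zero (jetCoef M (c x.1) (b x.2))
  refine ⟨Finset.univ.sup r, fun f v i J hJ => ?_⟩
  have h : jetCoef M f v = ∑ s, ∑ t, (c.repr f s * b.repr v t) • jetCoef M (c s) (b t) := by
    have e1 : ∀ s, M.coef (c s) v = ∑ t, b.repr v t • M.coef (c s) (b t) := by
      intro s
      conv_lhs => rw [← b.sum_repr v, map_sum]
      simp only [map_smul]
    have e2 : M.coef f v = ∑ s, c.repr f s • M.coef (c s) v := by
      conv_lhs => rw [← c.sum_repr f]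
      generalize c.repr f = g
      let L : Module.Dual ℂ V →ₗ[ℂ] CMHopf n :=
        { toFun := fun f => M.coef f v
          map_add' := fun f g => M.coef_add f g v
          map_smul' := fun r f => M.coef_smul r f v }
      change L _ = ∑ s, g s • L (c s)
      simp
    rw [jetCoef, e2]
    simp only [e1, Finset.smul_sum, map_sum, map_smul, smul_smul, jetCoef]
  rw [h]
  simp only [map_sum, Derivation.map_smul]
  refine Finset.sum_eq_zero fun s _ => Finset.sum_eq_zero fun t _ => ?_
  rw [hr (s, t) i J (lt_of_le_of_lt (Finset.le_sup (Finset.mem_univ _)) hJ), smul_zero]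

/-- If the top order occurring were some `|J| ≥ 2`, then `dX k` would produce the order `|J| + 1`,
which nothing else in `jetCoef_act_X` could cancel. -/
theorem jetDeriv_jetCoef [FiniteDimensional ℂ V] (hn : 1 ≤ n) (hM : M.IsAYD)
    (f : Module.Dual ℂ V) (v : V) (i : Fin n) (J : Multiset (Fin n)) :
    Jets.jetDeriv i J (jetCoef M f v) = 0 := by
  have hstep : ∀ r, 1 ≤ r → (∀ f v i J, r < J.card → Jets.jetDeriv i J (jetCoef M f v) = 0) →
      ∀ f v i J, 1 < J.card → Jets.jetDeriv i J (jetCoef M f v) = 0 := by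
    intro r hr
    induction r, hr using Nat.le_induction with
    | base => exact fun h => h
    | succ r hr ih =>
      refine fun h => ih fun f v i J hJ => ?_
      by_cases hJ' : r + 1 < J.card
      · exact h f v i J hJ'
      let k : Fin n := ⟨0, hn⟩
      have hc : r + 1 < (k ::ₘ J).card := by rw [Multiset.card_cons]; omega
      have h1 := congrArg (Jets.jetDeriv i (k ::ₘ J)) (jetCoef_act_X hM f v k)
      -- Here `k ::ₘ J` has `r + 2 ≥ 3` entries, so the second order factors are not seen.
      have h2 : ∀ s t, Jets.jetDeriv i (k ::ₘ J) (Jets.a s {t, k}) = 0 := by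
        intro s t
        rw [Jets.jetDeriv_a _ _ _ _ (by omega), if_neg]
        rintro ⟨-, h⟩
        rw [h] at hc
        simp at hc
        omega
      simp only [map_add, map_neg, map_sum, Derivation.leibniz, h2, h _ _ _ _ hc, smul_zero,
        Finset.sum_const_zero, add_zero, Jets.jetDeriv_dX _ _ _ (show 2 ≤ J.card by omega),
        map_zero, mul_zero, zero_add, sub_zero] at h1
      exact neg_eq_zero.1 h1.symm
  by_cases hJ : 1 < J.card
  · obtain ⟨r, hr⟩ := exists_jetDeriv_jetCoef (M := M)
    -- The bound `r` may be `0`, whereas the descent starts from a bound of at least `1`.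
    exact hstep (r + 1) (by omega) (fun f v i J hJ => hr f v i J (by omega)) f v i J hJ
  · rw [Jets.jetDeriv, dif_neg (by omega)]; rfl

theorem jetCoef_eq [FiniteDimensional ℂ V] (hn : 1 ≤ n) (hM : M.IsAYD)
    (f : Module.Dual ℂ V) (v : V) : jetCoef M f v = MvPolynomial.C (f v) := by
  rw [Jets.eq_C_of_jetDeriv _ (jetDeriv_jetCoef hn hM f v), jetCoef, Jets.constantCoeff_proj,
    ← counit_eq, hM.counit_coef]

/-- With constant jets, `jetCoef_act_X` is an affine relation among the variables `α^i_{jk}`, and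
its coefficient at `α^i_{jk}` is `f(v · Y_i^j) - δ_{ij} f(v)`. -/
theorem act_Y_eq [FiniteDimensional ℂ V] (hn : 1 ≤ n) (hM : M.IsAYD) (v : V) (i j : Fin n) :
    M.act v (Y i j) = if i = j then v else 0 := by
  rw [← sub_eq_zero, ← Module.forall_dual_apply_eq_zero_iff ℂ]
  intro f
  let k : Fin n := ⟨0, hn⟩
  have h1 := congrArg (Jets.jetDeriv i {j, k}) (jetCoef_act_X hM f v k)
  have h2 : (2 : ℕ) ≤ ({j, k} : Multiset (Fin n)).card := by simp
  -- For fixed `k` the variables `α^s_{tk}` are pairwise distinct, so the symmetry in the lower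
  -- indices merges no two terms.
  have hp : ∀ t : Fin n, ({j, k} : Multiset (Fin n)) = {t, k} ↔ j = t := by
    intro t
    rw [Multiset.pair_comm j, Multiset.pair_comm t, Multiset.insert_eq_cons,
      Multiset.insert_eq_cons, Multiset.cons_inj_right, Multiset.singleton_inj]
  simp only [jetCoef_eq hn hM, map_add, map_sum, Derivation.leibniz,
    Jets.jetDeriv_a _ _ _ _ h2, MvPolynomial.derivation_C, neg_zero, add_zero,
    zero_add, hp, ite_and, smul_eq_mul, mul_ite, mul_one, mul_zero, Finset.sum_ite_eq,
    Finset.mem_univ, if_true, sum_ite_const] at h1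
  have h3 := MvPolynomial.C_injective _ _ (h1.symm.trans MvPolynomial.C_0.symm)
  rw [LinearMap.sub_apply, precomp_apply] at h3
  rw [map_sub, ← h3]
  split_ifs <;> simp

end module

end CM

namespace CM

variable {n : ℕ}

open ActCoact

/-- The element `∑ Y_p^p`, whose adjoint action grades the Connes-Moscovici algebra. -/
noncomputable def euler (n : ℕ) : CMHopf n := ∑ p, Y p p

theorem euler_X (k : Fin n) : ⁅euler n, (X k : CMHopf n)⁆ = X k := by
  simp [euler, sum_lie', Y_X]

theorem euler_Y (i j : Fin n) : ⁅euler n, (Y i j : CMHopf n)⁆ = 0 := by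
  simp [euler, sum_lie', Y_Y]

theorem euler_al2 (i j k : Fin n) : ⁅euler n, (al2 i j k : CMHopf n)⁆ = al2 i j k := by
  simp [euler, sum_lie', Y_al2, Finset.sum_add_distrib]

/-! ### The grading by the Euler element and its degree zero part -/

section grading

open Polynomial

/-- The polynomials with coefficients in `F(N)`. -/
noncomputable def polyFN (n : ℕ) : Subalgebra ℂ (CMHopf n)[X] where
  carrier := {q | ∀ i, q.coeff i ∈ FN n}
  mul_mem' := fun hp hq i => by
    rw [coeff_mul]
    exact sum_mem fun x _ => mul_mem (hp _) (hq _)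
  add_mem' := fun hp hq i => by
    rw [coeff_add]
    exact add_mem (hp _) (hq _)
  algebraMap_mem' r i := by
    rw [Polynomial.algebraMap_apply, coeff_C]
    split_ifs
    · exact (FN n).algebraMap_mem r
    · exact zero_mem _

theorem C_lie_C (a b : CMHopf n) : ⁅C a, C b⁆ = C ⁅a, b⁆ := by
  simp [Ring.lie_def]

theorem C_lie_CX (a b : CMHopf n) : ⁅C a, C b * Polynomial.X⁆ = C ⁅a, b⁆ * Polynomial.X := by
  simp [Ring.lie_def, sub_mul, mul_assoc, X_mul_C]

theorem CX_mul_CX (a b : CMHopf n) : C a * Polynomial.X * (C b * Polynomial.X) =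
    C (a * b) * Polynomial.X ^ 2 := by
  rw [mul_assoc, ← mul_assoc Polynomial.X, X_mul_C, C_mul, pow_two]
  simp only [mul_assoc]

theorem CX_lie_CX (a b : CMHopf n) : ⁅C a * Polynomial.X, C b * Polynomial.X⁆ =
    C ⁅a, b⁆ * Polynomial.X ^ 2 := by
  rw [Ring.lie_def, CX_mul_CX, CX_mul_CX, ← sub_mul, ← C_sub, Ring.lie_def]

/-- The data of the grading of the Connes-Moscovici algebra. -/
noncomputable def gradeData (n : ℕ) : LiftData n (CMHopf n)[X] where
  x k := C (X k) * Polynomial.X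
  y i j := C (Y i j)
  p i j k := C (al2 i j k) * Polynomial.X
  S := polyFN n
  xx k l := by rw [CX_lie_CX, X_X, C_0, zero_mul]
  yy i j k l := by
    rw [C_lie_C, Y_Y, C_sub]
    split_ifs <;> simp
  yx i j k := by
    rw [C_lie_CX, Y_X]
    split_ifs <;> simp
  psymm i j k := by rw [al2_symm]
  yp a b i j k := by
    rw [C_lie_CX, Y_al2]
    split_ifs <;> simp [sub_mul, add_mul]
  bianchi i s k m := by
    simp only [CX_lie_CX, CX_mul_CX, ← sub_mul, ← Finset.sum_mul, ← C_sub, X_al2, ← map_sum]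
  S_comm p hp q hq := by
    ext i
    rw [coeff_mul, coeff_mul, ← Finset.Nat.sum_antidiagonal_swap]
    exact Finset.sum_congr rfl fun x _ => FN_comm _ (hp _) _ (hq _)
  p_mem i j k m := by
    rw [coeff_C_mul_X]
    split_ifs
    · exact al_mem _ _
    · exact zero_mem _
  x_mem k q hq m := by
    rw [Ring.lie_def, coeff_sub]
    cases m with
    | zero => simp [mul_assoc]
    | succ m =>
      have h1 : (C (X k) * Polynomial.X * q).coeff (m + 1) = X k * q.coeff m := by
        rw [mul_assoc, coeff_C_mul, coeff_X_mul]
      have h2 : (q * (C (X k) * Polynomial.X)).coeff (m + 1) = q.coeff m * X k := by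
        rw [← mul_assoc, coeff_mul_X, coeff_mul_C]
      rw [h1, h2]
      exact X_lie_mem k _ (hq m)

/-- The homogeneous component of degree `m`. -/
noncomputable def component (m : ℕ) (h : CMHopf n) : CMHopf n := ((gradeData n).lift h).coeff m

/-- The subalgebra generated by `gl(n)`. -/
noncomputable def algY (n : ℕ) : Subalgebra ℂ (CMHopf n) :=
  Algebra.adjoin ℂ (Set.range fun q : Fin n × Fin n => Y q.1 q.2)

/-- The constant coefficient of a polynomial is multiplicative, and the generators `X_k` and
`α^i_{jk}` have degree one. -/
theorem component_zero_mem (h : CMHopf n) : component 0 h ∈ algY n := by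
  let T : Subalgebra ℂ (CMHopf n) :=
    { carrier := {h | component 0 h ∈ algY n}
      mul_mem' := fun {a b} ha hb => by
        change component 0 (a * b) ∈ algY n
        rw [component, map_mul, mul_coeff_zero]
        exact mul_mem ha hb
      add_mem' := fun {a b} ha hb => by
        change component 0 (a + b) ∈ algY n
        rw [component, map_add, coeff_add]
        exact add_mem ha hb
      algebraMap_mem' := fun r => by
        change component 0 _ ∈ algY n
        rw [component, AlgHom.commutes, Polynomial.algebraMap_apply, coeff_C_zero]
        exact (algY n).algebraMap_mem r }
  refine generated T (fun k => ?_) (fun i j => ?_) (fun i j k => ?_) h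
  · change component 0 _ ∈ algY n
    rw [component, LiftData.lift_X]
    simp [gradeData]
  · change component 0 _ ∈ algY n
    rw [component, LiftData.lift_Y]
    simp only [gradeData, coeff_C_zero]
    exact Algebra.subset_adjoin ⟨(i, j), rfl⟩
  · change component 0 _ ∈ algY n
    rw [component, al2, LiftData.lift_al2]
    simp [gradeData]

/-- Setting the grading variable to `1` recovers the element, so each element is the sum of its
components. -/
theorem eval_grade (h : CMHopf n) : ((gradeData n).lift h).eval 1 = h := by
  let T : Subalgebra ℂ (CMHopf n) :=
    { carrier := {h | ((gradeData n).lift h).eval 1 = h}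
      mul_mem' := fun {a b} ha hb => by
        change _ = _
        have hb' : _ = b := hb
        have ha' : _ = a := ha
        -- Evaluation is multiplicative over this noncommutative ring because the point `1` is
        -- central.
        rw [map_mul, eval, eval₂_mul_noncomm _ _ fun k => Commute.one_right _]
        exact congrArg₂ (· * ·) ha' hb'
      add_mem' := fun {a b} ha hb => by
        change _ = _
        rw [map_add, eval_add, ha, hb]
      algebraMap_mem' := fun r => by
        change _ = _
        rw [AlgHom.commutes, Polynomial.algebraMap_apply, eval_C] }
  refine generated T (fun k => ?_) (fun i j => ?_) (fun i j k => ?_) h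
  · change _ = _
    rw [LiftData.lift_X]
    simp [gradeData]
  · change _ = _
    rw [LiftData.lift_Y]
    simp [gradeData]
  · change _ = _
    rw [al2, LiftData.lift_al2]
    simp [gradeData, al2]

theorem euler_lie_component (m : ℕ) (h : CMHopf n) :
    ⁅euler n, component m h⁆ = m • component m h := by
  let T : Subalgebra ℂ (CMHopf n) :=
    { carrier := {h | ∀ m, ⁅euler n, component m h⁆ = m • component m h}
      mul_mem' := fun {a b} ha hb m => by
        simp only [component, map_mul, coeff_mul, lie_sum', lie_mul', Finset.smul_sum]
        refine Finset.sum_congr rfl fun x hx => ?_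
        have h1 := ha x.1
        have h2 := hb x.2
        simp only [component] at h1 h2
        rw [h1, h2, ← Finset.HasAntidiagonal.mem_antidiagonal.1 hx, add_smul, smul_mul_assoc, mul_smul_comm]
      add_mem' := fun {a b} ha hb m => by
        have h1 := ha m
        have h2 := hb m
        simp only [component] at h1 h2
        simp only [component, map_add, coeff_add, lie_add', h1, h2, smul_add]
      algebraMap_mem' := fun r m => by
        rw [component, AlgHom.commutes, Polynomial.algebraMap_apply, coeff_C]
        split_ifs with hm
        · rw [hm, zero_smul, Ring.lie_def, Algebra.commutes]
          exact sub_self _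
        · rw [lie_zero', smul_zero] }
  refine generated T (fun k m => ?_) (fun i j m => ?_) (fun i j k m => ?_) h m
  · rw [component, LiftData.lift_X]
    simp only [gradeData, coeff_C_mul_X]
    split_ifs with hm
    · rw [hm, euler_X, one_smul]
    · rw [lie_zero', smul_zero]
  · rw [component, LiftData.lift_Y]
    simp only [gradeData, coeff_C]
    split_ifs with hm
    · rw [hm, euler_Y, zero_smul]
    · rw [lie_zero', smul_zero]
  · rw [component, al2, LiftData.lift_al2]
    simp only [gradeData, coeff_C_mul_X]
    split_ifs with hm
    · rw [hm, euler_al2, one_smul]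
    · rw [lie_zero', smul_zero]

/-- Bracketing with the Euler element multiplies the component of degree `m` by `m`, so an element
commuting with it is concentrated in degree zero. -/
theorem mem_algY_of_commute (c : CMHopf n) (hc : ∀ i j, ⁅(Y i j : CMHopf n), c⁆ = 0) :
    c ∈ algY n := by
  have h1 : (gradeData n).lift (euler n) = C (euler n) := by
    simp only [euler, map_sum, LiftData.lift_Y]; rfl
  have h2 : ⁅euler n, c⁆ = 0 := by simp [euler, sum_lie', hc]
  have h3 : ∀ m, m ≠ 0 → component m c = 0 := by
    intro m hm
    have h4 := congrArg (component m) h2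
    rw [Ring.lie_def, component, map_sub, map_mul, map_mul, h1, coeff_sub, coeff_C_mul,
      coeff_mul_C] at h4
    have h5 := euler_lie_component m c
    rw [Ring.lie_def, component] at h5
    rw [h5] at h4
    have h6 : component m (0 : CMHopf n) = 0 := by simp [component]
    rw [h6, ← Nat.cast_smul_eq_nsmul ℂ] at h4
    exact (smul_eq_zero.1 h4).resolve_left (Nat.cast_ne_zero.2 hm)
  have h4 : (gradeData n).lift c = C (component 0 c) := by
    ext m
    rw [coeff_C]
    split_ifs with hm
    · rw [hm]; rfl
    · exact h3 m hm
  rw [← eval_grade c, h4, eval_C]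
  exact component_zero_mem c

end grading

/-! ### The affine representation and detection of scalars in the algebra generated by `gl(n)` -/

section affine

open Matrix

/-- The data of the representation of the affine Lie algebra on `ℂⁿ⁺¹`. -/
noncomputable def affData (n : ℕ) : LiftData n (Matrix (Option (Fin n)) (Option (Fin n)) ℂ) where
  x k := Matrix.single (some k) none 1
  y i j := Matrix.single (some i) (some j) 1
  p _ _ _ := 0
  S := ⊥
  xx k l := by simp [Ring.lie_def]
  yy i j k l := by
    rw [Ring.lie_def]
    by_cases h1 : j = k <;> by_cases h2 : l = i <;> simp [h1, h2]
  yx i j k := by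
    rw [Ring.lie_def]
    by_cases h1 : j = k <;> simp [h1]
  psymm _ _ _ := rfl
  yp _ _ _ _ _ := by simp [Ring.lie_def]
  bianchi _ _ _ _ := by simp [Ring.lie_def]
  S_comm a ha b hb := by
    obtain ⟨r, rfl⟩ := Algebra.mem_bot.1 ha
    exact Algebra.commutes r b
  p_mem _ _ _ := zero_mem _
  x_mem k a ha := by
    obtain ⟨r, rfl⟩ := Algebra.mem_bot.1 ha
    rw [Ring.lie_def, Algebra.commutes, sub_self]
    exact zero_mem _

/-- Matrices of the affine representation are block triangular, and the quotient line carries the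
trivial representation. -/
theorem aff_none (h : CMHopf n) : (∀ j, (affData n).lift h none (some j) = 0) ∧
    (affData n).lift h none none = counit n h := by
  let T : Subalgebra ℂ (CMHopf n) :=
    { carrier := {h | (∀ j, (affData n).lift h none (some j) = 0) ∧
        (affData n).lift h none none = counit n h}
      mul_mem' := fun {a b} ha hb => by
        constructor
        · intro j
          simp [Matrix.mul_apply, Fintype.sum_option, ha.1, hb.1]
        · simp [Matrix.mul_apply, Fintype.sum_option, ha.1, ha.2, hb.2]
      add_mem' := fun {a b} ha hb => by
        constructor
        · intro j
          simp [ha.1, hb.1]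
        · simp [ha.2, hb.2]
      algebraMap_mem' := fun r => by
        constructor
        · intro j
          rw [AlgHom.commutes, Matrix.algebraMap_matrix_apply, if_neg (by simp)]
        · rw [AlgHom.commutes, AlgHom.commutes, Matrix.algebraMap_matrix_apply, if_pos rfl] }
  refine generated T (fun k => ?_) (fun i j => ?_) (fun i j k => ?_) h
  · refine ⟨fun j => ?_, ?_⟩ <;> rw [LiftData.lift_X] <;> simp [affData]
  · refine ⟨fun j => ?_, ?_⟩ <;> rw [LiftData.lift_Y] <;> simp [affData]
  · refine ⟨fun j => ?_, ?_⟩ <;> rw [al2, LiftData.lift_al2] <;> simp [affData]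
    exact (counit_al2 i j k).symm

/-- The difference of a matrix coefficient of the standard representation of `gl(n)` and the
matrix coefficient of the trivial representation. -/
noncomputable def stdDiff (i j : Fin n) : CMHopf n →ₗ[ℂ] ℂ where
  toFun h := (affData n).lift h (some i) (some j) - if i = j then counit n h else 0
  map_add' a b := by split_ifs <;> simp; ring
  map_smul' r a := by split_ifs <;> simp; ring

theorem stdDiff_apply (i j : Fin n) (h : CMHopf n) : stdDiff i j h =
    (affData n).lift h (some i) (some j) - if i = j then counit n h else 0 := rfl

/-- The translation `X_j` maps the last basis vector to the `j`-th. Comparing the `(i, none)`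
entries of `c X_j = X_j c` therefore gives `ρ(c)_{ij} = δ_{ij} ε(c)`. -/
theorem stdDiff_eq_zero (c : CMHopf n) (hc : ∀ k, c * X k = X k * c) (i j : Fin n) :
    stdDiff i j c = 0 := by
  have h := congrArg (fun a => (affData n).lift a (some i) none) (hc j)
  have h1 : (affData n).lift (X j) = Matrix.single (some j) none 1 := LiftData.lift_X ..
  simp only [map_mul, h1] at h
  rw [stdDiff_apply, ← (aff_none c).2]
  by_cases hij : i = j
  · subst hij
    simp at h
    simp [h]
  · rw [Matrix.mul_single_apply_same, Matrix.single_mul_apply_of_ne] at h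
    · simpa [hij] using h
    · simpa using hij

theorem stdDiff_mul_Y (i j p q : Fin n) (h : CMHopf n) : stdDiff i j (h * Y p q) =
    if q = j then stdDiff i p h + (if i = p then counit n h else 0) else 0 := by
  have h1 : (affData n).lift (Y p q) = Matrix.single (some p) (some q) 1 := LiftData.lift_Y ..
  simp only [stdDiff_apply, map_mul, h1, counit_Y, mul_zero, ite_self, sub_zero, sub_add_cancel]
  by_cases hq : q = j
  · subst hq; simp
  · rw [Matrix.mul_single_apply_of_ne, if_neg hq]
    simpa using fun h => hq h.symm

/-- The map `h ↦ h₍₁₎ l(h₍₂₎)`. -/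
noncomputable def contract (l : CMHopf n →ₗ[ℂ] ℂ) : CMHopf n →ₗ[ℂ] CMHopf n :=
  (TensorProduct.rid ℂ (CMHopf n)).toLinearMap ∘ₗ l.lTensor _ ∘ₗ (comul n).toLinearMap

/-- To leading order this is the product rule for a partial derivative along `Y_i^j`: the term `h`
appears when `(p, q) = (i, j)`. The other correction, `contract (stdDiff i p) h`, has smaller word
length. -/
theorem contract_mul_Y (i j p q : Fin n) (h : CMHopf n) : contract (stdDiff i j) (h * Y p q) =
    contract (stdDiff i j) h * Y p q +
      if q = j then contract (stdDiff i p) h + (if i = p then h else 0) else 0 := by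
  have h1 : ∀ u : CMHopf n ⊗[ℂ] CMHopf n,
      TensorProduct.rid ℂ _ ((stdDiff i j).lTensor _ (u * (Y p q ⊗ₜ 1 + 1 ⊗ₜ Y p q))) =
      TensorProduct.rid ℂ _ ((stdDiff i j).lTensor _ u) * Y p q + if q = j then
        TensorProduct.rid ℂ _ ((stdDiff i p).lTensor _ u) + (if i = p then
          TensorProduct.rid ℂ _ ((counit n).toLinearMap.lTensor _ u) else 0) else 0 := by
    intro u
    induction u using TensorProduct.induction_on with
    | zero => simp
    | add s t hs ht =>
      simp only [add_mul, map_add, hs, ht]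
      split_ifs <;> abel
    | tmul a b =>
      simp only [mul_add, Algebra.TensorProduct.tmul_mul_tmul, mul_one, map_add,
        LinearMap.lTensor_tmul, TensorProduct.rid_tmul, stdDiff_mul_Y, smul_mul_assoc]
      split_ifs <;> simp [add_smul]
  have h2 : TensorProduct.rid ℂ _ ((counit n).toLinearMap.lTensor _ (comul n h)) = h := by
    have := Coalgebra.lTensor_counit_comul (R := ℂ) h
    have h3 := congrArg (TensorProduct.rid ℂ (CMHopf n)) this
    rw [TensorProduct.rid_tmul, one_smul] at h3
    exact h3
  simp only [contract, LinearMap.comp_apply, AlgHom.toLinearMap_apply, map_mul, comul_Y,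
    LinearEquiv.coe_coe, h1, h2]

/-- The map `h ↦ ∑ h₍₁₎ (ρ_{ij}(h₍₂₎) - δ_{ij} ε(h₍₂₎)) Y_i^j`, `ρ` the standard representation. -/
noncomputable def count : CMHopf n →ₗ[ℂ] CMHopf n :=
  ∑ i, ∑ j, LinearMap.mulRight ℂ (Y i j) ∘ₗ contract (stdDiff i j)

theorem count_apply (h : CMHopf n) : count h = ∑ i, ∑ j, contract (stdDiff i j) h * Y i j := by
  simp [count]

/-- Each further letter adds one more copy of the word, as for an Euler operator; the last two sums
consist of shorter words. -/
theorem count_mul_Y (p q : Fin n) (h : CMHopf n) : count (h * Y p q) = count h * Y p q +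
    h * Y p q + ∑ i, ∑ j, contract (stdDiff i j) h * ⁅(Y p q : CMHopf n), Y i j⁆ +
      ∑ i, contract (stdDiff i p) h * Y i q := by
  simp only [count_apply, contract_mul_Y, add_mul, ite_mul, zero_mul, Finset.sum_add_distrib,
    Finset.sum_ite_eq, Finset.sum_ite_eq', Finset.mem_univ, if_true, Ring.lie_def, mul_sub,
    Finset.sum_sub_distrib, Finset.sum_mul, mul_assoc]
  abel

/-- The span of `1` and `gl(n)`. -/
noncomputable def spanY (n : ℕ) : Submodule ℂ (CMHopf n) :=
  Submodule.span ℂ (insert 1 (Set.range fun q : Fin n × Fin n => Y q.1 q.2))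

theorem one_mem_spanY : (1 : CMHopf n) ∈ spanY n := Submodule.subset_span (Or.inl rfl)

theorem Y_mem_spanY (i j : Fin n) : (Y i j : CMHopf n) ∈ spanY n :=
  Submodule.subset_span (Or.inr ⟨(i, j), rfl⟩)

theorem spanY_pow_le (m : ℕ) : spanY n ^ m ≤ spanY n ^ (m + 1) := by
  intro h hh
  rw [pow_succ]
  simpa using Submodule.mul_mem_mul hh one_mem_spanY

theorem spanY_pow_mul (m : ℕ) (h : CMHopf n) (hh : h ∈ spanY n ^ m) (i j : Fin n) :
    h * Y i j ∈ spanY n ^ (m + 1) := by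
  rw [pow_succ]
  exact Submodule.mul_mem_mul hh (Y_mem_spanY i j)

theorem contract_one (i j : Fin n) : contract (stdDiff i j) (1 : CMHopf n) = 0 := by
  have : stdDiff i j (1 : CMHopf n) = 0 := by
    rw [stdDiff_apply, map_one, map_one, Matrix.one_apply]
    simp
  simp [contract, Algebra.TensorProduct.one_def, this]

/-- The elements on which the counting map is multiplication by `m + 1` up to shorter words. -/
noncomputable def countSub (n m : ℕ) : Submodule ℂ (CMHopf n) :=
  (⨅ i, ⨅ j, (spanY n ^ m).comap (contract (stdDiff i j))) ⊓
    (spanY n ^ m).comap (count - ((m + 1 : ℕ) : ℂ) • LinearMap.id)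

theorem mem_countSub (m : ℕ) (h : CMHopf n) : h ∈ countSub n m ↔
    (∀ i j, contract (stdDiff i j) h ∈ spanY n ^ m) ∧
      count h - ((m + 1 : ℕ) : ℂ) • h ∈ spanY n ^ m := by
  simp [countSub, Submodule.mem_iInf]

/-- Induction on the word length: contractions lower it by one, and `count` multiplies by it modulo
shorter words. Working with the filtration by powers of `spanY`, no basis of the enveloping algebra
is needed. -/
theorem spanY_pow_le_countSub (m : ℕ) : spanY n ^ (m + 1) ≤ countSub n m := by
  induction m with
  | zero =>
    rw [zero_add, pow_one, spanY, Submodule.span_le]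
    rintro _ (rfl | ⟨⟨p, q⟩, rfl⟩)
    · rw [SetLike.mem_coe, mem_countSub, count_apply]
      simp only [contract_one, zero_mul, Finset.sum_const_zero, zero_sub]
      exact ⟨fun _ _ => zero_mem _, neg_mem (Submodule.smul_mem _ _ (by
        rw [pow_zero]; exact Submodule.one_le.1 le_rfl))⟩
    · have h1 : (1 : CMHopf n) ∈ spanY n ^ 0 := by
        rw [pow_zero]; exact Submodule.one_le.1 le_rfl
      rw [SetLike.mem_coe, mem_countSub]
      dsimp only
      -- A single letter is viewed as the empty word times a letter, so that the product formulas
      -- apply.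
      rw [← one_mul (Y p q)]
      constructor
      · intro i j
        rw [contract_mul_Y]
        simp only [contract_one, zero_mul, zero_add]
        split_ifs <;> first | exact h1 | exact zero_mem _
      · rw [count_mul_Y, count_apply]
        simp only [contract_one, zero_mul, Finset.sum_const_zero, zero_add, add_zero]
        simp
  | succ m ih =>
    rw [pow_succ, Submodule.mul_le]
    intro x hx
    have hx' := ih hx
    rw [mem_countSub] at hx'
    obtain ⟨hx1, hx2⟩ := hx'
    change spanY n ≤ (countSub n (m + 1)).comap (LinearMap.mulLeft ℂ x)
    rw [spanY, Submodule.span_le]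
    rintro _ (rfl | ⟨⟨p, q⟩, rfl⟩) <;>
      rw [SetLike.mem_coe, Submodule.mem_comap, LinearMap.mulLeft_apply, mem_countSub]
    · rw [mul_one]
      refine ⟨fun i j => spanY_pow_le m (hx1 i j), ?_⟩
      -- Here `x` is counted as one letter longer than it is; the surplus copy of `x` is itself a
      -- shorter word.
      have h1 := sub_mem (spanY_pow_le m hx2) hx
      convert h1 using 1
      push_cast
      module
    · constructor
      · intro i j
        rw [contract_mul_Y]
        refine add_mem (spanY_pow_mul _ _ (hx1 i j) p q) ?_
        split_ifs
        · exact add_mem (spanY_pow_le m (hx1 i p)) hx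
        · rw [add_zero]; exact spanY_pow_le m (hx1 i p)
        · exact zero_mem _
      · have h3 : ∑ i, ∑ j, contract (stdDiff i j) x * ⁅(Y p q : CMHopf n), Y i j⁆ ∈
            spanY n ^ (m + 1) := by
          refine sum_mem fun i _ => sum_mem fun j _ => ?_
          rw [Y_Y, mul_sub]
          refine sub_mem ?_ ?_ <;> split_ifs
          · exact spanY_pow_mul _ _ (hx1 i j) _ _
          · rw [mul_zero]; exact zero_mem _
          · exact spanY_pow_mul _ _ (hx1 i j) _ _
          · rw [mul_zero]; exact zero_mem _
        have h4 : ∑ i, contract (stdDiff i p) x * Y i q ∈ spanY n ^ (m + 1) :=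
          sum_mem fun i _ => spanY_pow_mul _ _ (hx1 i p) _ _
        have h5 := add_mem (add_mem (spanY_pow_mul _ _ hx2 p q) h3) h4
        convert h5 using 1
        rw [count_mul_Y, sub_mul, smul_mul_assoc]
        push_cast
        module

theorem mem_spanY_pow (c : CMHopf n) (hc : c ∈ algY n) : ∃ m, c ∈ spanY n ^ m := by
  have hle : ∀ {m m'}, m ≤ m' → spanY n ^ m ≤ spanY n ^ m' := fun h => monotone_nat_of_le_succ
    spanY_pow_le h
  induction hc using Algebra.adjoin_induction with
  | mem x hx =>
    obtain ⟨q, rfl⟩ := hx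
    exact ⟨1, by rw [pow_one]; exact Y_mem_spanY _ _⟩
  | algebraMap r => exact ⟨0, by rw [pow_zero]; exact Submodule.algebraMap_mem r⟩
  | add x y _ _ hx hy =>
    obtain ⟨m, hx⟩ := hx
    obtain ⟨m', hy⟩ := hy
    exact ⟨max m m', add_mem (hle (le_max_left _ _) hx) (hle (le_max_right _ _) hy)⟩
  | mul x y _ _ hx hy =>
    obtain ⟨m, hx⟩ := hx
    obtain ⟨m', hy⟩ := hy
    exact ⟨m + m', by rw [pow_add]; exact Submodule.mul_mem_mul hx hy⟩

/-- If all contractions vanish then `count c = 0`, so for `c` of length at most `m + 1` the multiple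
`(m + 1) c` has length at most `m`. Dividing and repeating brings `c` down to length zero. -/
theorem scalar_of_contract (c : CMHopf n) (hc : c ∈ algY n)
    (h0 : ∀ i j, contract (stdDiff i j) c = 0) : ∃ r : ℂ, c = algebraMap ℂ _ r := by
  obtain ⟨m, hm⟩ := mem_spanY_pow c hc
  induction m with
  | zero =>
    rw [pow_zero, Submodule.mem_one] at hm
    obtain ⟨r, hr⟩ := hm
    exact ⟨r, hr.symm⟩
  | succ m ih =>
    have h1 := ((mem_countSub m c).1 (spanY_pow_le_countSub m hm)).2
    have h2 : count c = 0 := by simp [count_apply, h0]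
    rw [h2, zero_sub, neg_mem_iff] at h1
    exact ih ((Submodule.smul_mem_iff _ (Nat.cast_ne_zero.2 (Nat.succ_ne_zero m))).1 h1)

end affine

/-! ### The action is `δ` and the coaction is trivial -/

section module

variable {V : Type*} [AddCommGroup V] [Module ℂ V] {M : ActCoact (CMHopf n) V}

theorem act_lie (hM : M.IsAYD) (v : V) (h k : CMHopf n) :
    M.act v ⁅h, k⁆ = M.act (M.act v h) k - M.act (M.act v k) h := by
  rw [Ring.lie_def, map_sub, hM.act_mul, hM.act_mul]

variable [FiniteDimensional ℂ V]

/-- `X_k` is its own commutator with `Y_k^k`, which acts as the identity. -/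
theorem act_X_eq_zero (hn : 1 ≤ n) (hM : M.IsAYD) (v : V) (k : Fin n) : M.act v (X k) = 0 := by
  have h1 := act_lie hM v (Y k k) (X k)
  rw [Y_X, if_pos rfl, act_Y_eq hn hM, if_pos rfl, act_Y_eq hn hM, if_pos rfl, sub_self] at h1
  exact h1

theorem act_al2_eq_zero (hn : 1 ≤ n) (hM : M.IsAYD) (v : V) (i j k : Fin n) :
    M.act v (al2 i j k) = 0 := by
  rw [← euler_al2, euler, sum_lie', map_sum]
  refine Finset.sum_eq_zero fun p _ => ?_
  rw [act_lie hM, act_Y_eq hn hM, if_pos rfl, act_Y_eq hn hM, if_pos rfl, sub_self]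

theorem act_eq (hn : 1 ≤ n) (hM : M.IsAYD) (v : V) (h : CMHopf n) :
    M.act v h = modularChar n h • v := by
  let T : Subalgebra ℂ (CMHopf n) :=
    { carrier := {h | ∀ v, M.act v h = modularChar n h • v}
      mul_mem' := fun {a b} ha hb v => by rw [hM.act_mul, hb, ha, map_mul, smul_smul, mul_comm]
      add_mem' := fun {a b} ha hb v => by rw [map_add, ha, hb, map_add, add_smul]
      algebraMap_mem' := fun r v => by
        rw [AlgHom.commutes, Algebra.algebraMap_eq_smul_one, map_smul, hM.act_one]
        rfl }
  refine generated T (fun k v => ?_) (fun i j v => ?_) (fun i j k v => ?_) h v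
  · rw [act_X_eq_zero hn hM, modularChar_X, zero_smul]
  · rw [act_Y_eq hn hM, modularChar_Y]
    split_ifs <;> simp
  · rw [act_al2_eq_zero hn hM, modularChar_al2, zero_smul]

/-- When the action is by a character, each `precomp f h` is a multiple of `f`, so the identities
for the generators involve the single element `M.coef f v` and become commutation relations. -/
theorem coef_commute (hn : 1 ≤ n) (hM : M.IsAYD) (f : Module.Dual ℂ V) (v : V) :
    (∀ i j, ⁅(Y i j : CMHopf n), M.coef f v⁆ = 0) ∧ ∀ k, M.coef f v * X k = X k * M.coef f v := by
  have hY : ∀ i j : Fin n, M.precomp f (Y i j) = if i = j then f else 0 := by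
    intro i j
    ext w
    rw [precomp_apply, act_Y_eq hn hM]
    split_ifs <;> simp
  have hX : ∀ k : Fin n, M.precomp f (X k) = 0 := by
    intro k; ext w; rw [precomp_apply, act_X_eq_zero hn hM]; simp
  have hal : ∀ i j k : Fin n, M.precomp f (al2 i j k) = 0 := by
    intro i j k; ext w; rw [precomp_apply, act_al2_eq_zero hn hM]; simp
  have h1 : ∀ i j k : Fin n, M.coef f v * al2 i j k = al2 i j k * M.coef f v := by
    intro i j k
    have := coef_act_al2 hM f v i j k
    rw [act_al2_eq_zero hn hM, hal, coef_zero, map_zero, add_zero] at this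
    exact (sub_eq_zero.1 this.symm)
  constructor
  · intro i j
    have := coef_act_Y hM f v i j
    rw [act_Y_eq hn hM, hY] at this
    rw [Ring.lie_def]
    split_ifs at this
    · rw [add_sub_right_comm, right_eq_add] at this
      rw [← neg_sub, this, neg_zero]
    · rw [coef_zero, map_zero, add_zero] at this
      rw [← neg_sub, ← this, neg_zero]
  · intro k
    have h2 := coef_act_X hM f v k
    have h3 : ∀ i j, M.coef (M.precomp f (Y i j)) v = if i = j then M.coef f v else 0 := by
      intro i j; rw [hY]; split_ifs <;> simp [coef_zero]
    -- After moving the coefficient past `α` by `h1`, the trace from `S(X_k)` cancels the one from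
    -- the action of `Y_i^j`, and only the commutator with `X_k` is left.
    have h4 := sum_Y_al2 (n := n) k
    simp only [Ring.lie_def, Finset.sum_sub_distrib] at h4
    rw [sub_eq_iff_eq_add, ← sub_eq_iff_eq_add'] at h4
    rw [act_X_eq_zero hn hM, hX, coef_zero, map_zero, antipode_X, ← h4] at h2
    simp only [h3, hal, coef_zero, mul_assoc, h1, mul_zero, sub_zero, Finset.sum_sub_distrib,
      ite_mul, zero_mul, Finset.sum_ite_eq, Finset.mem_univ, if_true, add_mul, sub_mul, neg_mul,
      Finset.sum_mul, trAl, add_zero] at h2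
    rw [← sub_eq_zero, h2]
    abel

/-- `stdDiff i j` vanishes on every matrix coefficient, hence so does its contraction with one, by
coassociativity. The coefficient is then a scalar, and the counit axiom identifies it as `f v`. -/
theorem coact_eq (hn : 1 ≤ n) (hM : M.IsAYD) (v : V) : M.coact v = 1 ⊗ₜ v := by
  refine M.tmul_eq_of_coef v fun f => ?_
  obtain ⟨r, hr⟩ := scalar_of_contract (M.coef f v)
    (mem_algY_of_commute _ (coef_commute hn hM f v).1) fun i j => by
      have h1 : contract (stdDiff i j) (M.coef f v) = _ :=
        hM.lTensor_comul_coef (stdDiff i j) f v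
      rw [h1, show stdDiff i j ∘ₗ M.coef f = 0 from LinearMap.ext fun w =>
        stdDiff_eq_zero _ (coef_commute hn hM f w).2 i j, coef_zero]
  have h2 := hM.counit_coef f v
  rw [hr, counit_eq, AlgHom.commutes] at h2
  rw [hr, ← h2]
  rfl

end module

end CM

theorem mainTheorem11 (n : ℕ) (hn : 1 ≤ n) :
    (CM.Cdelta n).IsAYD ∧
    ∀ (V : Type*) [AddCommGroup V] [Module ℂ V] [FiniteDimensional ℂ V]
      (M : ActCoact (CMHopf n) V), M.IsAYD →
      Nonempty (ActCoact.Iso M ((CM.Cdelta n).copies (Module.finrank ℂ V))) :=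
  ⟨CM.Cdelta_isAYD n, fun _ _ _ _ _ hM =>
    ActCoact.nonempty_iso_copies _ (CM.act_eq hn hM) (CM.coact_eq hn hM)⟩
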